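/- Let $d\ge 3$, let $T_d=(V,\mathcal E)$ be the infinite $d$-regular tree with root $o\in V$, and let $\omega\in\Omega=\{0,1\}^V$ be Bernoulli site percolation on $T_d$ with parameter $1/2$, with law $\mathbb P$. An automorphism $g\in\operatorname{Aut}(T_d)$ acts on $\Omega$ by $(g\omega)(x)=\omega(g^{-1}x)$ and on $\ell^2(V)$ by the unitary $U_g\delta_x=\delta_{gx}$. A random operator $F=(F_\omega)_{\omega\in\Omega}$ on $\ell^2(V)$ (each $F_\omega$ a bounded operator, with measurable matrix coefficients) is called equivariant if, for every $g\in\operatorname{Aut}(T_d)$, $F_{g\omega}=U_gF_\omega U_g^{-1}$ almost surely; put $$\tau(F)=\mathbb E\,\langle\delta_o,F_\omega\delta_o\rangle .$$ A random set $W_\omega\subseteq V$ is called equivariant if, for every $g\in\operatorname{Aut}(T_d)$, $W_{g\omega}=gW_\omega$ almost surely. For a self-adjoint bounded operator $A$ and a Borel set $B\subseteq\mathbb R$, let $\mathbf 1_B(A)$ denote the spectral projection of $A$ associated with $B$. Let $P_\omega$ be a bounded self-adjoint equivariant random operator on $\ell^2(V)$, let $W_\omega\subseteq V$ be an equivariant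 random set, and let $Q_\omega$ be multiplication by $\mathbf 1_{W_\omega}$. Fix $E\in\mathbb R$ and suppose that $$\mathbf 1_{[E,\infty)}\bigl((1-Q_\omega)P_\omega(1-Q_\omega)\bigr)=0\qquad\text{almost surely}.$$ Then $\langle\delta_o,\mathbf 1_{[E,\infty)}(P_\omega)\delta_o\rangle$ is integrable and $$\tau\bigl(\mathbf 1_{[E,\infty)}(P_\omega)\bigr)\le\tau(Q_\omega)=\mathbb P(o\in W_\omega).$$ If, in addition, the same hypothesis holds with $P_\omega$ replaced by $-P_\omega$, that is, $\mathbf 1_{[E,\infty)}\bigl((1-Q_\omega)(-P_\omega)(1-Q_\omega)\bigr)=0$ almost surely, then $\langle\delta_o,\mathbf 1_{(-\infty,-E]\cup[E,\infty)}(P_\omega)\delta_o\rangle$ is integrable and $$\tau\bigl(\mathbf 1_{(-\infty,-E]\cup[E,\infty)}(P_\omega)\bigr)\le 2\,\mathbb P(o\in W_\omega).$$ -/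

import Mathlib

open MeasureTheory Filter Topology CompactlySupported
open scoped ENNReal InnerProductSpace

noncomputable section

namespace TreeOperator

section Spectral

variable {H : Type*} [NormedAddCommGroup H] [InnerProductSpace ℂ H] [CompleteSpace H]

/-- The positive linear functional `f ↦ ⟨x, f(A) x⟩` on `C_c(ℝ)`, for a self-adjoint operator `A`. -/
def spectralFunctional (A : H →L[ℂ] H) (x : H) : C_c(ℝ, ℝ) →ₚ[ℝ] ℝ :=
  PositiveLinearMap.mk₀
    { toFun := fun f => (⟪x, cfc (f : ℝ → ℝ) A x⟫_ℂ).re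
      map_add' := fun f g => by
        rw [CompactlySupportedContinuousMap.coe_add, Pi.add_def,
          cfc_add A (f : ℝ → ℝ) (g : ℝ → ℝ)
            f.continuous.continuousOn g.continuous.continuousOn]
        simp
      map_smul' := fun c f => by
        rw [CompactlySupportedContinuousMap.coe_smul, Pi.smul_def,
          cfc_smul c (f : ℝ → ℝ) A f.continuous.continuousOn]
        have h : (c • cfc (f : ℝ → ℝ) A) x = (c : ℂ) • (cfc (f : ℝ → ℝ) A x) := rfl
        rw [h, inner_smul_right]
        simp }
    (fun f hf => by
      have h0 : (0 : H →L[ℂ] H) ≤ cfc (f : ℝ → ℝ) A := cfc_nonneg fun t _ => hf t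
      have h1 := ((ContinuousLinearMap.nonneg_iff_isPositive _).1 h0).re_inner_nonneg_right x
      exact h1)

/-- The spectral measure `μ_x` of the self-adjoint operator `A` at the vector `x`: the Radon measure
on `ℝ` with `∫ f dμ_x = ⟨x, f(A) x⟩` for all `f ∈ C_c(ℝ)`. -/
def spectralMeasure (A : H →L[ℂ] H) (x : H) : Measure ℝ :=
  RealRMK.rieszMeasure (spectralFunctional A x)

instance (A : H →L[ℂ] H) (x : H) : (spectralMeasure A x).Regular :=
  RealRMK.regular_rieszMeasure _

theorem integral_spectralMeasure (A : H →L[ℂ] H) (x : H) (f : C_c(ℝ, ℝ)) :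
    ∫ t, f t ∂(spectralMeasure A x) = (⟪x, cfc (f : ℝ → ℝ) A x⟫_ℂ).re :=
  RealRMK.integral_rieszMeasure _ f

theorem integrable_spectralMeasure (A : H →L[ℂ] H) (x : H) (f : C_c(ℝ, ℝ)) :
    Integrable (fun t => f t) (spectralMeasure A x) :=
  f.continuous.integrable_of_hasCompactSupport f.hasCompactSupport

theorem spectralMeasure_univ_le (A : H →L[ℂ] H) (x : H) :
    spectralMeasure A x Set.univ ≤ ENNReal.ofReal (‖x‖ ^ 2) := by
  rw [Measure.Regular.innerRegular.measure_eq_iSup isOpen_univ]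
  refine iSup₂_le fun K _ => iSup_le fun hK => ?_
  obtain ⟨f, hf1, -, hfc, hf01⟩ := exists_continuous_one_zero_of_isCompact hK
    isClosed_empty (Set.disjoint_empty K)
  let F : C_c(ℝ, ℝ) := ⟨f, hfc⟩
  refine (RealRMK.rieszMeasure_le_of_eq_one (spectralFunctional A x) (f := F)
    (fun t => (hf01 t).1) hK (fun t ht => hf1 ht)).trans (ENNReal.ofReal_le_ofReal ?_)
  change (⟪x, cfc (f : ℝ → ℝ) A x⟫_ℂ).re ≤ ‖x‖ ^ 2
  have hn : ‖cfc (f : ℝ → ℝ) A‖ ≤ 1 := by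
    refine norm_cfc_le zero_le_one fun t _ => ?_
    rw [Real.norm_eq_abs, abs_of_nonneg (hf01 t).1]
    exact (hf01 t).2
  calc (⟪x, cfc (f : ℝ → ℝ) A x⟫_ℂ).re ≤ ‖x‖ * ‖cfc (f : ℝ → ℝ) A x‖ :=
        (Complex.re_le_norm _).trans (norm_inner_le_norm _ _)
    _ ≤ ‖x‖ * (1 * ‖x‖) := by
        gcongr
        exact ContinuousLinearMap.le_of_opNorm_le _ hn x
    _ = ‖x‖ ^ 2 := by ring

instance (A : H →L[ℂ] H) (x : H) : IsFiniteMeasure (spectralMeasure A x) :=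
  ⟨(spectralMeasure_univ_le A x).trans_lt ENNReal.ofReal_lt_top⟩

theorem spectralMeasure_add_le (A : H →L[ℂ] H) (x y : H) (s : Set ℝ) :
    spectralMeasure A (x + y) s ≤ 2 * spectralMeasure A x s + 2 * spectralMeasure A y s := by
  have key : spectralMeasure A (x + y) + spectralMeasure A (x - y)
      = (spectralMeasure A x + spectralMeasure A x)
        + (spectralMeasure A y + spectralMeasure A y) := by
    apply Measure.ext_of_integral_eq_on_compactlySupported
    intro f
    have hi := fun z => integrable_spectralMeasure A z f
    rw [integral_add_measure (hi _) (hi _),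
      integral_add_measure ((hi _).add_measure (hi _)) ((hi _).add_measure (hi _)),
      integral_add_measure (hi _) (hi _), integral_add_measure (hi _) (hi _)]
    simp only [integral_spectralMeasure, map_add, map_sub, inner_add_left, inner_add_right,
      inner_sub_left, inner_sub_right, Complex.add_re, Complex.sub_re]
    ring
  calc spectralMeasure A (x + y) s
      ≤ (spectralMeasure A (x + y) + spectralMeasure A (x - y)) s := by
        rw [Measure.add_apply]; exact le_self_add
    _ = _ := by rw [key]; simp only [Measure.add_apply, two_mul]

theorem spectralMeasure_smul (A : H →L[ℂ] H) (c : ℂ) (x : H) :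
    spectralMeasure A (c • x) = (‖c‖₊ ^ 2) • spectralMeasure A x := by
  apply Measure.ext_of_integral_eq_on_compactlySupported
  intro f
  rw [integral_smul_nnreal_measure]
  simp only [integral_spectralMeasure, map_smul, inner_smul_left, inner_smul_right]
  rw [← mul_assoc, Complex.mul_conj']
  rw [NNReal.smul_def, smul_eq_mul]
  rw [← Complex.ofReal_pow, Complex.re_ofReal_mul]
  simp

/-- The spectral subspace of `A` for the set `B`: the vectors `x` whose spectral measure `μ_x` does
not charge the complement of `B`. -/
def spectralSubspace (A : H →L[ℂ] H) (B : Set ℝ) : Submodule ℂ H where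
  carrier := {x | spectralMeasure A x Bᶜ = 0}
  add_mem' {x y} hx hy := by
    have hx' : spectralMeasure A x Bᶜ = 0 := hx
    have hy' : spectralMeasure A y Bᶜ = 0 := hy
    refine nonpos_iff_eq_zero.1 ((spectralMeasure_add_le A x y Bᶜ).trans ?_)
    simp [hx', hy']
  zero_mem' := by
    refine nonpos_iff_eq_zero.1
      ((measure_mono (Set.subset_univ _)).trans ((spectralMeasure_univ_le A 0).trans ?_))
    simp
  smul_mem' c x hx := by
    have hx' : spectralMeasure A x Bᶜ = 0 := hx
    simp [spectralMeasure_smul, hx']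

theorem mem_spectralSubspace {A : H →L[ℂ] H} {B : Set ℝ} {x : H} :
    x ∈ spectralSubspace A B ↔ spectralMeasure A x Bᶜ = 0 := Iff.rfl

theorem isClosed_spectralSubspace (A : H →L[ℂ] H) (B : Set ℝ) :
    IsClosed (spectralSubspace A B : Set H) := by
  refine isClosed_of_closure_subset fun x hx => ?_
  obtain ⟨u, hu, hlim⟩ := mem_closure_iff_seq_limit.1 hx
  have hb : ∀ n, spectralMeasure A x Bᶜ ≤ 2 * ENNReal.ofReal (‖x - u n‖ ^ 2) := fun n => by
    have h1 := spectralMeasure_add_le A (x - u n) (u n) Bᶜ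
    have h2 : spectralMeasure A (u n) Bᶜ = 0 := hu n
    rw [sub_add_cancel, h2, mul_zero, add_zero] at h1
    refine h1.trans ?_
    gcongr
    exact (measure_mono (Set.subset_univ _)).trans (spectralMeasure_univ_le A _)
  have hl : Tendsto (fun n => 2 * ENNReal.ofReal (‖x - u n‖ ^ 2)) atTop (𝓝 0) := by
    have h3 : Tendsto (fun n => ‖x - u n‖ ^ 2) atTop (𝓝 0) := by
      simpa using ((tendsto_const_nhds (x := x)).sub hlim).norm.pow 2
    have h4 := ENNReal.Tendsto.const_mul (a := 2) (ENNReal.tendsto_ofReal h3)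
      (Or.inr (by simp))
    simpa using h4
  exact nonpos_iff_eq_zero.1 (ge_of_tendsto' hl hb)

instance (A : H →L[ℂ] H) (B : Set ℝ) : (spectralSubspace A B).HasOrthogonalProjection :=
  haveI : CompleteSpace (spectralSubspace A B) :=
    (isClosed_spectralSubspace A B).completeSpace_coe
  inferInstance

/-- The spectral projection `1_B(A)` of the self-adjoint operator `A`: the orthogonal projection
onto the spectral subspace. By `inner_spectralProjection` below it is the operator given by the
Borel functional calculus, `⟨x, 1_B(A) x⟩ = μ_x(B)`. -/
def spectralProjection (A : H →L[ℂ] H) (B : Set ℝ) : H →L[ℂ] H :=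
  (spectralSubspace A B).starProjection

theorem spectralMeasure_compl_Icc (A : H →L[ℂ] H) (x : H) :
    spectralMeasure A x (Set.Icc (-‖A‖) ‖A‖)ᶜ = 0 := by
  rw [Measure.Regular.innerRegular.measure_eq_iSup isClosed_Icc.isOpen_compl]
  refine nonpos_iff_eq_zero.1 (iSup₂_le fun K hKs => iSup_le fun hK => ?_)
  obtain ⟨f, hf1, hf0, hfc, hf01⟩ := exists_continuous_one_zero_of_isCompact hK
    (isClosed_Icc (a := -‖A‖) (b := ‖A‖)) (Set.disjoint_left.2 hKs)
  let F : C_c(ℝ, ℝ) := ⟨f, hfc⟩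
  refine (RealRMK.rieszMeasure_le_of_eq_one (spectralFunctional A x) (f := F)
    (fun t => (hf01 t).1) hK (fun t ht => hf1 ht)).trans ?_
  have h0 : spectralFunctional A x F = (⟪x, cfc (f : ℝ → ℝ) A x⟫_ℂ).re := rfl
  have h1 : cfc (f : ℝ → ℝ) A = cfc (fun _ => (0 : ℝ)) A := cfc_congr fun t ht => by
    apply hf0
    have := spectrum.norm_le_norm_mul_of_mem ht
    have h2 : ‖(1 : H →L[ℂ] H)‖ ≤ 1 := ContinuousLinearMap.norm_id_le
    have h3 : |t| ≤ ‖A‖ := by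
      rw [← Real.norm_eq_abs]
      nlinarith [norm_nonneg A]
    exact abs_le.1 h3
  rw [h0, h1]
  simp

theorem integral_spectralMeasure_of_continuous (A : H →L[ℂ] H) (x : H) {f : ℝ → ℝ}
    (hf : Continuous f) :
    ∫ t, f t ∂(spectralMeasure A x) = (⟪x, cfc f A x⟫_ℂ).re := by
  obtain ⟨χ, hχ1, -, hχc, -⟩ := exists_continuous_one_zero_of_isCompact
    (isCompact_Icc (a := -‖A‖) (b := ‖A‖)) isClosed_empty (Set.disjoint_empty _)
  let F : C_c(ℝ, ℝ) := ⟨⟨fun t => f t * χ t, hf.mul χ.continuous⟩, hχc.mul_left⟩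
  have h1 : cfc f A = cfc (F : ℝ → ℝ) A := cfc_congr fun t ht => by
    have := spectrum.norm_le_norm_mul_of_mem ht
    have h2 : ‖(1 : H →L[ℂ] H)‖ ≤ 1 := ContinuousLinearMap.norm_id_le
    have h3 : |t| ≤ ‖A‖ := by
      rw [← Real.norm_eq_abs]
      nlinarith [norm_nonneg A]
    have h4 : χ t = 1 := hχ1 (abs_le.1 h3)
    change f t = f t * χ t
    rw [h4, mul_one]
  rw [h1, ← integral_spectralMeasure]
  refine integral_congr_ae ?_
  filter_upwards [mem_ae_iff.2 (spectralMeasure_compl_Icc A x)] with t ht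
  have h4 : χ t = 1 := hχ1 ht
  change f t = f t * χ t
  rw [h4, mul_one]

theorem integrable_spectralMeasure_of_continuous (A : H →L[ℂ] H) (x : H) {f : ℝ → ℝ}
    (hf : Continuous f) : Integrable f (spectralMeasure A x) := by
  have h := (hf.continuousOn (s := Set.Icc (-‖A‖) ‖A‖)).integrableOn_compact
    (μ := spectralMeasure A x) isCompact_Icc
  have hr : (spectralMeasure A x).restrict (Set.Icc (-‖A‖) ‖A‖) = spectralMeasure A x :=
    Measure.restrict_eq_self_of_ae_mem (mem_ae_iff.2 (spectralMeasure_compl_Icc A x))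
  rwa [IntegrableOn, hr] at h

theorem norm_sq_cfc_apply {A : H →L[ℂ] H} (x : H) {f : ℝ → ℝ}
    (hf : Continuous f) :
    ‖cfc f A x‖ ^ 2 = ∫ t, f t ^ 2 ∂(spectralMeasure A x) := by
  rw [integral_spectralMeasure_of_continuous A x (f := fun t => f t ^ 2) (hf.pow 2)]
  have h : cfc (fun t => f t ^ 2) A = cfc f A * cfc f A := by
    rw [← cfc_mul f f A hf.continuousOn hf.continuousOn]
    exact cfc_congr fun t _ => pow_two _
  have hs : IsSelfAdjoint (cfc f A) := cfc_predicate f A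
  have h2 : ⟪x, cfc f A (cfc f A x)⟫_ℂ = ⟪cfc f A x, cfc f A x⟫_ℂ :=
    (hs.isSymmetric x (cfc f A x)).symm
  rw [h, mul_apply_eq_comp, h2, inner_self_eq_norm_sq_to_K]
  norm_cast

theorem norm_cfc_apply_le {A : H →L[ℂ] H} (x : H) {f : ℝ → ℝ} (hf : Continuous f) {ε : ℝ}
    (hε : 0 ≤ ε) (h : eLpNorm f 2 (spectralMeasure A x) ≤ ENNReal.ofReal ε) :
    ‖cfc f A x‖ ≤ ε := by
  have hm : MemLp f 2 (spectralMeasure A x) :=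
    ⟨hf.aestronglyMeasurable, h.trans_lt ENNReal.ofReal_lt_top⟩
  have h1 := hm.eLpNorm_eq_integral_rpow_norm (by norm_num) (by norm_num)
  rw [h1] at h
  have h2 := (ENNReal.ofReal_le_ofReal_iff hε).1 h
  have h3 : ∫ t, ‖f t‖ ^ (2 : ℝ) ∂(spectralMeasure A x) = ‖cfc f A x‖ ^ 2 := by
    rw [norm_sq_cfc_apply x hf]
    refine integral_congr_ae (.of_forall fun t => ?_)
    simp
  simp only [ENNReal.toReal_ofNat] at h2
  rwa [h3, ← one_div, ← Real.sqrt_eq_rpow, Real.sqrt_sq (norm_nonneg _)] at h2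

theorem spectralMeasure_cfc_apply_compl_le {A : H →L[ℂ] H} (x : H) {f : ℝ → ℝ}
    (hf : Continuous f) {B : Set ℝ} (hB : MeasurableSet B) :
    spectralMeasure A (cfc f A x) Bᶜ
      ≤ eLpNorm (B.indicator 1 - f) 2 (spectralMeasure A x) ^ 2 := by
  have hint := integrable_spectralMeasure_of_continuous A x (f := fun t => f t ^ 2) (hf.pow 2)
  have hfin : IsFiniteMeasure
      ((spectralMeasure A x).withDensity fun t => ENNReal.ofReal (f t ^ 2)) :=
    isFiniteMeasure_withDensity_ofReal hint.2
  have key : spectralMeasure A (cfc f A x)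
      = (spectralMeasure A x).withDensity fun t => ENNReal.ofReal (f t ^ 2) := by
    apply Measure.ext_of_integral_eq_on_compactlySupported
    intro g
    rw [integral_spectralMeasure, integral_withDensity_eq_integral_toReal_smul (by fun_prop)
      (.of_forall fun t => ENNReal.ofReal_lt_top)]
    have hs : IsSelfAdjoint (cfc f A) := cfc_predicate f A
    have h2 : ⟪cfc f A x, cfc (g : ℝ → ℝ) A (cfc f A x)⟫_ℂ
        = ⟪x, cfc f A (cfc (g : ℝ → ℝ) A (cfc f A x))⟫_ℂ :=
      hs.isSymmetric x _
    have h3 : cfc (fun t => f t * (g t * f t)) A = cfc f A * (cfc (g : ℝ → ℝ) A * cfc f A) := by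
      rw [← cfc_mul (g : ℝ → ℝ) f A g.continuous.continuousOn hf.continuousOn]
      exact cfc_mul f (fun t => g t * f t) A hf.continuousOn (g.continuous.mul hf).continuousOn
    have h4 := integral_spectralMeasure_of_continuous A x (f := fun t => f t * (g t * f t))
      (hf.mul (g.continuous.mul hf))
    rw [h3] at h4
    rw [h2]
    refine h4.symm.trans (integral_congr_ae (.of_forall fun t => ?_))
    simp only [ENNReal.toReal_ofReal (sq_nonneg (f t)), smul_eq_mul]
    ring
  rw [key, withDensity_apply _ hB.compl,
    eLpNorm_eq_lintegral_rpow_enorm_toReal (by norm_num) (by norm_num), ← ENNReal.rpow_natCast,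
    ← ENNReal.rpow_mul]
  simp only [ENNReal.toReal_ofNat, Nat.cast_ofNat, ne_eq, OfNat.ofNat_ne_zero, not_false_eq_true,
    one_div, inv_mul_cancel₀, ENNReal.rpow_one]
  rw [← lintegral_indicator hB.compl]
  refine lintegral_mono fun t => ?_
  by_cases ht : t ∈ B
  · simp [ht]
  · simp [ht, Real.enorm_eq_ofReal_abs, ← ENNReal.ofReal_pow]

/-- The defining property of the Borel functional calculus, `⟨x, 1_B(A) x⟩ = μ_x(B)`. -/
theorem inner_spectralProjection {A : H →L[ℂ] H} (hA : IsSelfAdjoint A) {B : Set ℝ}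
    (hB : MeasurableSet B) (x : H) :
    ⟪x, spectralProjection A B x⟫_ℂ = ((spectralMeasure A x).real B : ℂ) := by
  set K := spectralSubspace A B
  set p := spectralProjection A B x with hp
  have hpK : p ∈ K := K.starProjection_apply_mem x
  have hperp : ∀ w ∈ K, ⟪x, w⟫_ℂ = ⟪p, w⟫_ℂ := fun w hw => by
    have := K.starProjection_inner_eq_zero x w hw
    rwa [inner_sub_left, sub_eq_zero] at this
  have hmem : MemLp (B.indicator (1 : ℝ → ℝ)) 2 (spectralMeasure A x + spectralMeasure A p) :=
    (memLp_const (1 : ℝ)).indicator hB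
  have hex : ∀ n : ℕ, ∃ g : ℝ → ℝ, Continuous g ∧
      eLpNorm (B.indicator 1 - g) 2 (spectralMeasure A x + spectralMeasure A p)
        ≤ ENNReal.ofReal (1 / (n + 1)) := fun n => by
    obtain ⟨g, -, h1, h2, -⟩ := hmem.exists_hasCompactSupport_eLpNorm_sub_le (by norm_num)
      (ε := ENNReal.ofReal (1 / (n + 1))) (by simp; positivity)
    exact ⟨g, h2, h1⟩
  choose f hfc hf using hex
  have hε : ∀ n : ℕ, (0 : ℝ) ≤ 1 / (n + 1) := fun n => by positivity
  have hεt : Tendsto (fun n : ℕ => (1 : ℝ) / (n + 1)) atTop (𝓝 0) :=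
    tendsto_one_div_add_atTop_nhds_zero_nat
  have hfx : ∀ n, eLpNorm (B.indicator 1 - f n) 2 (spectralMeasure A x)
      ≤ ENNReal.ofReal (1 / (n + 1)) := fun n =>
    (eLpNorm_mono_measure _ (Measure.le_add_right le_rfl)).trans (hf n)
  have hfp : ∀ n, eLpNorm (B.indicator 1 - f n) 2 (spectralMeasure A p)
      ≤ ENNReal.ofReal (1 / (n + 1)) := fun n =>
    (eLpNorm_mono_measure _ (Measure.le_add_left le_rfl)).trans (hf n)
  have hind : Measurable (B.indicator (1 : ℝ → ℝ)) := measurable_one.indicator hB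
  set u : ℕ → H := fun n => cfc (f n) A x
  have hsub : ∀ n m, ‖u n - u m‖ ≤ 1 / (n + 1) + 1 / (m + 1) := fun n m => by
    have h1 : u n - u m = cfc (fun t => f n t - f m t) A x := by
      rw [cfc_sub (f n) (f m) A (hfc n).continuousOn (hfc m).continuousOn]
      rfl
    rw [h1]
    refine norm_cfc_apply_le x ((hfc n).sub (hfc m)) (add_nonneg (hε n) (hε m)) ?_
    have h2 : f n - f m
        = (B.indicator 1 - f m) - (B.indicator 1 - f n) := by
      ext t; simp
    change eLpNorm (f n - f m) 2 (spectralMeasure A x) ≤ _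
    rw [h2, ENNReal.ofReal_add (hε n) (hε m), add_comm]
    exact (eLpNorm_sub_le (hind.sub (hfc m).measurable).aestronglyMeasurable
      (hind.sub (hfc n).measurable).aestronglyMeasurable (by norm_num)).trans
      (add_le_add (hfx m) (hfx n))
  have hcau : CauchySeq u := by
    refine cauchySeq_of_le_tendsto_0 (fun N : ℕ => (1 : ℝ) / (N + 1) + 1 / (N + 1)) ?_ ?_
    · intro n m N hn hm
      rw [dist_eq_norm]
      refine (hsub n m).trans ?_
      gcongr
    · simpa using hεt.add hεt
  obtain ⟨y, hy⟩ := cauchySeq_tendsto_of_complete hcau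
  have hyK : y ∈ K := by
    have hb : ∀ n, spectralMeasure A y Bᶜ
        ≤ 2 * ENNReal.ofReal (‖y - u n‖ ^ 2) + 2 * ENNReal.ofReal (1 / (n + 1)) ^ 2 := fun n => by
      have h1 := spectralMeasure_add_le A (y - u n) (u n) Bᶜ
      rw [sub_add_cancel] at h1
      refine h1.trans ?_
      gcongr
      · exact (measure_mono (Set.subset_univ _)).trans (spectralMeasure_univ_le A _)
      · refine (spectralMeasure_cfc_apply_compl_le x (hfc n) hB).trans ?_
        gcongr
        exact hfx n
    have hl : Tendsto (fun n : ℕ => 2 * ENNReal.ofReal (‖y - u n‖ ^ 2)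
        + 2 * ENNReal.ofReal (1 / (n + 1)) ^ 2) atTop (𝓝 0) := by
      have h3 : Tendsto (fun n => ‖y - u n‖ ^ 2) atTop (𝓝 0) := by
        simpa using ((tendsto_const_nhds (x := y)).sub hy).norm.pow 2
      have h4 := ENNReal.Tendsto.const_mul (a := 2) (ENNReal.tendsto_ofReal h3)
        (Or.inr (by simp))
      have h5 := ENNReal.Tendsto.const_mul (a := 2) (ENNReal.Tendsto.pow (n := 2) (ENNReal.tendsto_ofReal hεt))
        (Or.inr (by simp))
      simpa using h4.add h5
    exact nonpos_iff_eq_zero.1 (ge_of_tendsto' hl hb)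
  have hpy : ⟪p, y⟫_ℂ = ⟪p, x⟫_ℂ := by
    have h1 : Tendsto (fun n => ⟪p, u n⟫_ℂ) atTop (𝓝 ⟪p, y⟫_ℂ) := tendsto_const_nhds.inner hy
    have h2 : Tendsto (fun n => cfc (f n) A p) atTop (𝓝 p) := by
      rw [tendsto_iff_norm_sub_tendsto_zero]
      refine squeeze_zero (fun _ => norm_nonneg _) (fun n => ?_) hεt
      have h3 : cfc (f n) A p - p = cfc (fun t => f n t - 1) A p := by
        rw [cfc_sub (f n) (fun _ => 1) A (hfc n).continuousOn continuousOn_const,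
          cfc_const_one ℝ A]
        rfl
      rw [h3]
      refine norm_cfc_apply_le p ((hfc n).sub continuous_const) (hε n) ?_
      refine (eLpNorm_congr_norm_ae ?_).trans_le (hfp n)
      have h6 : ∀ᵐ t ∂(spectralMeasure A p), t ∈ B := mem_ae_iff.2 hpK
      filter_upwards [h6] with t ht
      simp [ht, abs_sub_comm]
    have h3 : Tendsto (fun n => ⟪cfc (f n) A p, x⟫_ℂ) atTop (𝓝 ⟪p, x⟫_ℂ) :=
      h2.inner tendsto_const_nhds
    refine tendsto_nhds_unique h1 (h3.congr fun n => ?_)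
    have hs : IsSelfAdjoint (cfc (f n) A) := cfc_predicate _ A
    exact hs.isSymmetric p x
  have hxy : (⟪x, y⟫_ℂ).re = (spectralMeasure A x).real B := by
    have h1 : Tendsto (fun n => (⟪x, u n⟫_ℂ).re) atTop (𝓝 (⟪x, y⟫_ℂ).re) :=
      (Complex.continuous_re.tendsto _).comp (tendsto_const_nhds.inner hy)
    have h2 : Tendsto (fun n => ∫ t, f n t ∂(spectralMeasure A x)) atTop
        (𝓝 (∫ t, B.indicator (1 : ℝ → ℝ) t ∂(spectralMeasure A x))) := by
      refine tendsto_integral_of_L1' _ hind.aestronglyMeasurable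
        (.of_forall fun n => integrable_spectralMeasure_of_continuous A x (hfc n)) ?_
      have hc : ∀ n : ℕ, eLpNorm (f n - B.indicator 1) 1 (spectralMeasure A x)
          ≤ ENNReal.ofReal (1 / (n + 1)) * spectralMeasure A x Set.univ ^ (1 / 2 : ℝ) := by
        intro n
        refine (eLpNorm_le_eLpNorm_mul_rpow_measure_univ (q := 2) (by norm_num)
          ((hfc n).measurable.sub hind).aestronglyMeasurable).trans ?_
        rw [eLpNorm_sub_comm]
        have h7 : (1 / ENNReal.toReal 1 - 1 / ENNReal.toReal 2 : ℝ) = 1 / 2 := by norm_num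
        rw [h7]
        gcongr
        exact hfx n
      have hl := ENNReal.Tendsto.mul_const (b := spectralMeasure A x Set.univ ^ (1 / 2 : ℝ))
        (ENNReal.tendsto_ofReal hεt) (Or.inr (by finiteness))
      rw [ENNReal.ofReal_zero, zero_mul] at hl
      exact tendsto_of_tendsto_of_tendsto_of_le_of_le tendsto_const_nhds hl
        (fun _ => bot_le) hc
    rw [integral_indicator_one hB] at h2
    refine tendsto_nhds_unique h1 (h2.congr fun n => ?_)
    exact integral_spectralMeasure_of_continuous A x (hfc n)
  have e1 : ⟪x, p⟫_ℂ = (‖p‖ ^ 2 : ℝ) := by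
    rw [hperp p hpK, inner_self_eq_norm_sq_to_K]
    norm_cast
  have e2 : ⟪x, y⟫_ℂ = (‖p‖ ^ 2 : ℝ) := by
    rw [hperp y hyK, hpy, ← inner_conj_symm, e1, Complex.conj_ofReal]
  rw [e1, ← hxy, e2, Complex.ofReal_re]

end Spectral

section RandomOperators

/-- The complex Hilbert space of square-summable functions on the vertex set `V`. -/
abbrev EllTwo (V : Type*) : Type _ := lp (fun _ : V => ℂ) 2

/-- Percolation configurations on `V`; `ω x = true` means that the site `x` is open. -/
abbrev Config (V : Type*) : Type _ := V → Bool

/-- Bernoulli site percolation with parameter `1/2`: the product over all sites of the uniform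
measure on `{closed, open}`. -/
def percolation (V : Type*) : Measure (Config V) :=
  Measure.infinitePi fun _ : V => (PMF.uniformOfFintype Bool).toMeasure

instance (V : Type*) : IsProbabilityMeasure (percolation V) := by
  unfold percolation; infer_instance

variable {V : Type*}

open Classical in
/-- The unit vector `δ_x`. -/
def delta (x : V) : EllTwo V := lp.single 2 x (1 : ℂ)

theorem sum_sq_le {ι : Type*} (f : EllTwo ι) (s : Finset ι) :
    ∑ i ∈ s, ‖f i‖ ^ (2 : ℝ≥0∞).toReal ≤ ‖f‖ ^ (2 : ℝ≥0∞).toReal :=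
  lp.sum_rpow_le_norm_rpow (by norm_num) f s

/-- Precomposition with a bijection, as a linear map of `ℓ²(V)`. -/
def compEquiv (e : V ≃ V) : EllTwo V →ₗ[ℂ] EllTwo V where
  toFun f := ⟨fun x => f (e x), memℓp_gen <| by
    have h := (memℓp_gen_iff (by norm_num)).1 (lp.memℓp f)
    exact h.comp_injective e.injective⟩
  map_add' _ _ := rfl
  map_smul' _ _ := rfl

/-- The unitary operator `(U_e f)(x) = f (e⁻¹ x)` on `ℓ²(V)` attached to a bijection `e` of `V`. -/
def permUnitary (e : V ≃ V) : EllTwo V ≃ₗᵢ[ℂ] EllTwo V where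
  toLinearEquiv := LinearEquiv.ofLinearMap (compEquiv e.symm) (compEquiv e)
    (by ext f x; exact congrArg (f : V → ℂ) (e.apply_symm_apply x))
    (by ext f x; exact congrArg (f : V → ℂ) (e.symm_apply_apply x))
  norm_map' f := by
    rw [lp.norm_eq_tsum_rpow (by norm_num), lp.norm_eq_tsum_rpow (by norm_num)]
    congr 1
    exact e.symm.tsum_eq fun x => ‖f x‖ ^ (2 : ℝ≥0∞).toReal

theorem permUnitary_delta (e : V ≃ V) (x : V) : permUnitary e (delta x) = delta (e x) := by
  ext y
  change (delta x : EllTwo V) (e.symm y) = (delta (e x) : EllTwo V) y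
  simp only [delta, lp.single_apply, Pi.single_apply]
  congr 1
  exact propext e.symm_apply_eq

/-- Multiplication by the indicator function of `W`, as an operator on `ℓ²(V)`. -/
def mulIndicator (W : Set V) : EllTwo V →L[ℂ] EllTwo V :=
  LinearMap.mkContinuous
    { toFun := fun f => ⟨W.indicator fun x => f x, (lp.memℓp f).mono' fun x => by
        by_cases h : x ∈ W <;> simp [h]⟩
      map_add' := fun f g => by
        ext x
        change W.indicator (fun x => f x + g x) x
          = W.indicator (fun x => f x) x + W.indicator (fun x => g x) x
        by_cases h : x ∈ W <;> simp [h]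
      map_smul' := fun c f => by
        ext x; by_cases h : x ∈ W <;> simp [h] }
    1 (fun f => by
      rw [one_mul]
      refine lp.norm_le_of_forall_sum_le (by norm_num) (norm_nonneg f) fun s =>
        (Finset.sum_le_sum fun x _ => ?_).trans (sum_sq_le f s)
      by_cases h : x ∈ W <;> simp [h])

variable (T : SimpleGraph V)

/-- The action of graph automorphisms on configurations: `(g ω)(x) = ω (g⁻¹ x)`. -/
def shift {T : SimpleGraph V} (g : T ≃g T) (ω : Config V) : Config V := fun x => ω (g.symm x)

/-- `F` is an equivariant random operator: every `F ω` is a bounded operator, its matrix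
coefficients are random variables, and `F (g ω) = U_g (F ω) U_g⁻¹` for every automorphism `g`.
As equivariant random operators are considered modulo almost sure equality, measurability is up to
null sets, and the covariance relation is required, for each `g`, almost surely. No uniform bound
in `ω` on the norm of `F ω` is asked for. -/
structure IsEquivariantOperator (F : Config V → EllTwo V →L[ℂ] EllTwo V) : Prop where
  aemeasurable : ∀ x y, AEMeasurable (fun ω => ⟪delta x, F ω (delta y)⟫_ℂ) (percolation V)
  equivariant : ∀ g : T ≃g T, ∀ᵐ ω ∂(percolation V),
    F (shift g ω) = (permUnitary g.toEquiv : EllTwo V →L[ℂ] EllTwo V) ∘L F ω ∘L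
      ((permUnitary g.toEquiv).symm : EllTwo V →L[ℂ] EllTwo V)

/-- `W` is an equivariant random set of vertices: the events `x ∈ W ω` are measurable (up to null
sets), and `W (g ω) = g (W ω)` almost surely, for every automorphism `g`. -/
structure IsEquivariantSet (W : Config V → Set V) : Prop where
  nullMeasurable : ∀ x, NullMeasurableSet {ω | x ∈ W ω} (percolation V)
  equivariant : ∀ g : T ≃g T, ∀ᵐ ω ∂(percolation V), W (shift g ω) = g '' W ω

/-- The diagonal matrix coefficient `⟨δ_o, F_ω δ_o⟩`. -/
def rootCoeff (o : V) (F : Config V → EllTwo V →L[ℂ] EllTwo V) (ω : Config V) : ℂ :=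
  ⟪delta o, F ω (delta o)⟫_ℂ

/-- The trace `τ(F) = 𝔼 ⟨δ_o, F_ω δ_o⟩`. -/
def vnTrace (o : V) (F : Config V → EllTwo V →L[ℂ] EllTwo V) : ℂ :=
  ∫ ω, rootCoeff o F ω ∂(percolation V)

end RandomOperators

end TreeOperator

end

open TreeOperator
open scoped ComplexOrder

/-! Let $R_\omega=\mathbf 1_{[E,\infty)}(P_\omega)$. The ranges of $R$ and $1-Q$ meet only in $0$:
if $Rx=x$ and $Qx=0$, then $\langle x,(1-Q)P(1-Q)x\rangle=\langle x,Px\rangle\ge E\|x\|^2$, whereas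
the hypothesis on the compression makes its form strictly below $E\|x\|^2$ for every $x\ne0$
(`eq_zero_of_spectralProjection_compression_eq_zero`).

It remains to compare traces: two equivariant projections with $\operatorname{ran}R\cap\ker Q=0$
satisfy $\tau(R)\le\tau(Q)$ (`integral_re_rootCoeff_le`). Instead of a polar decomposition of $QR$,
the proof uses the contractions $1-RQR$. Their fixed space is $\ker R$, so by the mean ergodic
theorem the averages of $(1-RQR)^k$ converge to $1-R$. The trace property gives
$\tau((1-RQR)^k)=\tau((1-QRQ)^k)$. The latter is at least $\mathbb P(o\notin W)$, because
$(1-QRQ)^k$ is positive and fixes $\delta_o$ whenever $o\notin W$. Averaging and passing to the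
limit yields $1-\tau(R)\ge1-\mathbb P(o\in W)$.

The trace property (`vnTrace_mul_comm`) holds because some automorphism of a regular tree swaps any
two given vertices, and percolation is invariant under it. It is applied only to products built from
projections, which have uniform norm bounds; $P_\omega$ itself need not be bounded uniformly in
$\omega$.

The two-sided bound is the one-sided bound for $P$ and for $-P$, added. -/

namespace SimpleGraph

/-! ### Geodesic convexity in trees -/

variable {V : Type*} {T : SimpleGraph V}

/-- A set of vertices that contains every vertex on a geodesic between two of its points. -/
def GeodesicallyConvex (T : SimpleGraph V) (A : Set V) : Prop :=
  ∀ a ∈ A, ∀ c ∈ A, ∀ u, T.dist a u + T.dist u c = T.dist a c → u ∈ A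

/-- Geodesics to $c$ through $a$ and through $b$ are both paths from $v$ to $c$; paths in a tree are
unique, so their second vertices agree. -/
theorem IsTree.eq_of_adj_of_dist_eq (hT : T.IsTree) {v a b c : V} (ha : T.Adj v a)
    (hb : T.Adj v b) (hac : T.dist v c = T.dist a c + 1) (hbc : T.dist v c = T.dist b c + 1) :
    a = b := by
  obtain ⟨p, hp⟩ := hT.connected.exists_walk_length_eq_dist a c
  obtain ⟨q, hq⟩ := hT.connected.exists_walk_length_eq_dist b c
  have hp' : (Walk.cons ha p).IsPath := Walk.isPath_of_length_eq_dist _ (by simp [hp, hac])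
  have hq' : (Walk.cons hb q).IsPath := Walk.isPath_of_length_eq_dist _ (by simp [hq, hbc])
  have h := congrArg Subtype.val
    ((hT.isAcyclic.subsingleton_path v c).elim ⟨_, hp'⟩ ⟨_, hq'⟩)
  simpa using congrArg Walk.snd h

/-- In a tree the distances from $c$ to two adjacent vertices differ by exactly one. If $v$ were the
nearer one, it would lie on the geodesic from $a$ to $c$, hence in $A$. -/
theorem GeodesicallyConvex.dist_eq_of_adj {A : Set V} (hT : T.IsTree)
    (hA : GeodesicallyConvex T A) {v a c : V} (ha : a ∈ A) (hv : v ∉ A) (hva : T.Adj v a)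
    (hc : c ∈ A) : T.dist v c = T.dist a c + 1 := by
  have h1 : T.dist a v = 1 := dist_eq_one_iff_adj.2 hva.symm
  rcases hT.dist_eq_dist_add_one_of_adj c hva with h | h
  · rwa [dist_comm, T.dist_comm (u := a)]
  · refine absurd (hA a ha c hc v ?_) hv
    rw [h1, T.dist_comm (u := v), T.dist_comm (u := a), h, add_comm]

/-- Every geodesic from $v$ into $A$ takes its first step to $a$; the rest of it is a geodesic
between points of $A$. -/
theorem GeodesicallyConvex.insert {A : Set V} (hT : T.IsTree)
    (hA : GeodesicallyConvex T A) {v a : V} (ha : a ∈ A) (hv : v ∉ A) (hva : T.Adj v a) :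
    GeodesicallyConvex T (insert v A) := by
  have key : ∀ c ∈ A, ∀ u, T.dist v u + T.dist u c = T.dist v c → u ∈ Insert.insert v A := by
    intro c hc u hu
    by_cases huv : u = v
    · exact Or.inl huv
    refine Or.inr (hA a ha c hc u ?_)
    have hvc := hA.dist_eq_of_adj hT ha hv hva hc
    obtain ⟨p, hp⟩ := hT.connected.exists_walk_length_eq_dist v u
    cases p with
    | nil => exact absurd rfl huv
    | @cons _ b _ hvb q =>
      have h1 : T.dist b u ≤ q.length := dist_le q
      have h2 : T.dist b c ≤ T.dist b u + T.dist u c := hT.connected.dist_triangle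
      have h3 : T.dist v c ≤ T.dist v b + T.dist b c := hT.connected.dist_triangle
      have h4 : T.dist v b = 1 := dist_eq_one_iff_adj.2 hvb
      have h5 : T.dist v u ≤ T.dist v b + T.dist b u := hT.connected.dist_triangle
      rw [Walk.length_cons] at hp
      have hab : a = b := hT.eq_of_adj_of_dist_eq hva hvb hvc (by omega)
      subst hab
      omega
  rintro x (rfl | hx) y (rfl | hy) u hu
  · rw [dist_self, Nat.add_eq_zero_iff, hT.connected.dist_eq_zero_iff] at hu
    exact Or.inl hu.1.symm
  · exact key y hy u hu
  · refine key x hx u ?_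
    rw [T.dist_comm (u := y) (v := u), T.dist_comm (u := u) (v := x),
      T.dist_comm (u := y) (v := x), add_comm]
    exact hu
  · exact Or.inr (hA x hx y hy u hu)

theorem geodesicallyConvex_singleton (hT : T.IsTree) (x : V) : GeodesicallyConvex T {x} := by
  rintro a rfl c rfl u hu
  rw [dist_self, Nat.add_eq_zero_iff, hT.connected.dist_eq_zero_iff] at hu
  exact hu.1.symm

/-- The graph of a distance preserving bijection between geodesically convex sets. -/
structure IsPartialIsometry (T : SimpleGraph V) (S : Set (V × V)) : Prop where
  dist_eq : ∀ p ∈ S, ∀ q ∈ S, T.dist p.1 q.1 = T.dist p.2 q.2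
  convex_fst : GeodesicallyConvex T (Prod.fst '' S)
  convex_snd : GeodesicallyConvex T (Prod.snd '' S)

/-! ### Extending partial isometries to automorphisms -/

namespace IsPartialIsometry

variable {S : Set (V × V)}

theorem fst_preimage_swap (S : Set (V × V)) : Prod.fst '' (Prod.swap ⁻¹' S) = Prod.snd '' S := by
  ext; simp

theorem snd_preimage_swap (S : Set (V × V)) : Prod.snd '' (Prod.swap ⁻¹' S) = Prod.fst '' S := by
  ext; simp

theorem swap (h : IsPartialIsometry T S) : IsPartialIsometry T (Prod.swap ⁻¹' S) where
  dist_eq p hp q hq := (h.dist_eq _ hp _ hq).symm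
  convex_fst := by rw [fst_preimage_swap]; exact h.convex_snd
  convex_snd := by rw [snd_preimage_swap]; exact h.convex_fst

theorem singleton (hT : T.IsTree) (x y : V) : IsPartialIsometry T {(x, y)} where
  dist_eq := by rintro p rfl q rfl; simp
  convex_fst := by rw [Set.image_singleton]; exact geodesicallyConvex_singleton hT x
  convex_snd := by rw [Set.image_singleton]; exact geodesicallyConvex_singleton hT y

/-- Distances are still preserved because, from every old point, the new vertex on either side is
exactly one step farther than its attaching vertex $a$ or $b$. -/
theorem insert (hT : T.IsTree) (h : IsPartialIsometry T S) {a b v w : V} (hab : (a, b) ∈ S)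
    (hv : v ∉ Prod.fst '' S) (hw : w ∉ Prod.snd '' S) (hva : T.Adj v a) (hwb : T.Adj w b) :
    IsPartialIsometry T (insert (v, w) S) where
  dist_eq := by
    have key : ∀ q ∈ S, T.dist v q.1 = T.dist w q.2 := fun q hq => by
      rw [h.convex_fst.dist_eq_of_adj hT ⟨_, hab, rfl⟩ hv hva ⟨q, hq, rfl⟩,
        h.convex_snd.dist_eq_of_adj hT ⟨_, hab, rfl⟩ hw hwb ⟨q, hq, rfl⟩,
        h.dist_eq _ hab q hq]
    rintro p (rfl | hp) q (rfl | hq)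
    · simp
    · exact key q hq
    · rw [dist_comm, key p hp, dist_comm]
    · exact h.dist_eq p hp q hq
  convex_fst := by
    rw [Set.image_insert_eq]; exact h.convex_fst.insert hT ⟨_, hab, rfl⟩ hv hva
  convex_snd := by
    rw [Set.image_insert_eq]; exact h.convex_snd.insert hT ⟨_, hab, rfl⟩ hw hwb

/-- Upper bounds for Zorn's lemma: each condition involves only two pairs at a time, and two pairs
lie in a common member of the chain. -/
theorem sUnion {c : Set (Set (V × V))} (hc : IsChain (· ⊆ ·) c)
    (h : ∀ S ∈ c, IsPartialIsometry T S) : IsPartialIsometry T (⋃₀ c) := by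
  have key : ∀ p ∈ ⋃₀ c, ∀ q ∈ ⋃₀ c, ∃ S ∈ c, p ∈ S ∧ q ∈ S := by
    rintro p ⟨S, hS, hp⟩ q ⟨S', hS', hq⟩
    rcases hc.total hS hS' with hle | hle
    · exact ⟨S', hS', hle hp, hq⟩
    · exact ⟨S, hS, hp, hle hq⟩
  refine ⟨fun p hp q hq => ?_, ?_, ?_⟩
  · obtain ⟨S, hS, h1, h2⟩ := key p hp q hq
    exact (h S hS).dist_eq p h1 q h2
  · rintro _ ⟨p, hp, rfl⟩ _ ⟨q, hq, rfl⟩ u hu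
    obtain ⟨S, hS, h1, h2⟩ := key p hp q hq
    exact Set.image_mono (Set.subset_sUnion_of_mem hS)
      ((h S hS).convex_fst _ ⟨p, h1, rfl⟩ _ ⟨q, h2, rfl⟩ u hu)
  · rintro _ ⟨p, hp, rfl⟩ _ ⟨q, hq, rfl⟩ u hu
    obtain ⟨S, hS, h1, h2⟩ := key p hp q hq
    exact Set.image_mono (Set.subset_sUnion_of_mem hS)
      ((h S hS).convex_snd _ ⟨p, h1, rfl⟩ _ ⟨q, h2, rfl⟩ u hu)

theorem eq_iff (hT : T.IsTree) (h : IsPartialIsometry T S) {a b a' b' : V} (hab : (a, b) ∈ S)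
    (hab' : (a', b') ∈ S) : a = a' ↔ b = b' := by
  rw [← hT.connected.dist_eq_zero_iff, ← hT.connected.dist_eq_zero_iff (u := b),
    h.dist_eq _ hab _ hab']

theorem adj_iff (h : IsPartialIsometry T S) {a b a' b' : V} (hab : (a, b) ∈ S)
    (hab' : (a', b') ∈ S) : T.Adj a a' ↔ T.Adj b b' := by
  rw [← dist_eq_one_iff_adj, ← dist_eq_one_iff_adj, h.dist_eq _ hab _ hab']

/-- In a regular tree a partial isometry whose domain is not everything can be extended. -/
theorem exists_insert [T.LocallyFinite] {d : ℕ} (hT : T.IsTree) (hreg : T.IsRegularOfDegree d)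
    (h : IsPartialIsometry T S) (hne : S.Nonempty) (hS : Prod.fst '' S ≠ Set.univ) :
    ∃ v w, (v, w) ∉ S ∧ IsPartialIsometry T (Insert.insert (v, w) S) := by
  classical
  obtain ⟨u, hu⟩ := (Set.ne_univ_iff_exists_notMem _).1 hS
  obtain ⟨⟨a₀, b₀⟩, h₀⟩ := hne
  obtain ⟨p⟩ := hT.connected.preconnected a₀ u
  -- A walk from the domain to a vertex outside must cross the boundary; `e.snd` is the vertex to be
  -- added, attached at $a$.
  obtain ⟨e, -, ⟨⟨a, b⟩, hab, hae⟩, hv⟩ := p.exists_boundary_dart (Prod.fst '' S) ⟨_, h₀, rfl⟩ hu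
  have hva : T.Adj e.snd a := by rw [show a = e.fst from hae]; exact e.adj.symm
  by_contra! hcon
  -- If no extension exists, every neighbour of $b$ is already the image of a neighbour of $a$ other
  -- than `e.snd`. This injects $d$ neighbours into $d-1$.
  have hall : ∀ w ∈ T.neighborFinset b, ∃ x ∈ (T.neighborFinset a).erase e.snd, (x, w) ∈ S := by
    intro w hw
    rw [mem_neighborFinset] at hw
    by_cases hwS : w ∈ Prod.snd '' S
    · obtain ⟨⟨x, w⟩, hx, rfl⟩ := hwS
      refine ⟨x, Finset.mem_erase.2 ⟨?_, ?_⟩, hx⟩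
      · rintro rfl
        exact hv ⟨_, hx, rfl⟩
      · rw [mem_neighborFinset]
        exact (h.adj_iff hab hx).2 hw
    · exact absurd (h.insert hT hab hv hwS hva hw.symm) (hcon _ _ fun hmem => hv ⟨_, hmem, rfl⟩)
  choose! f hf hfS using hall
  have hle := Finset.card_le_card_of_injOn f hf fun w hw w' hw' hww =>
    (h.eq_iff hT (hfS w hw) (hfS w' hw')).1 hww
  rw [Finset.card_erase_of_mem (by simpa using hva.symm), card_neighborFinset_eq_degree,
    card_neighborFinset_eq_degree, hreg.degree_eq, hreg.degree_eq] at hle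
  -- With truncated subtraction, $d\le d-1$ is contradictory only when $d>0$.
  have hpos : 0 < T.degree a := (T.degree_pos_iff_exists_adj a).2 ⟨_, hva.symm⟩
  rw [hreg.degree_eq] at hpos
  omega

/-- In a regular tree every partial isometry extends to an automorphism. -/
theorem exists_iso [T.LocallyFinite] {d : ℕ} (hT : T.IsTree) (hreg : T.IsRegularOfDegree d)
    (h : IsPartialIsometry T S) (hne : S.Nonempty) :
    ∃ g : T ≃g T, ∀ p ∈ S, g p.1 = p.2 := by
  obtain ⟨M, hSM, hM⟩ := zorn_subset_nonempty {S | IsPartialIsometry T S}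
    (fun c hc hchain _ => ⟨⋃₀ c, sUnion hchain hc, fun s hs => Set.subset_sUnion_of_mem hs⟩) S h
  have hMiso : IsPartialIsometry T M := hM.prop
  have h1 : Prod.fst '' M = Set.univ := by
    by_contra hcon
    obtain ⟨v, w, hvw, hi⟩ := hMiso.exists_insert hT hreg (hne.mono hSM) hcon
    exact hvw (hM.le_of_ge hi (Set.subset_insert _ _) (Set.mem_insert _ _))
  -- Surjectivity is the domain statement for the inverse relation, which is again a partial
  -- isometry.
  have h2 : Prod.snd '' M = Set.univ := by
    by_contra hcon
    rw [← fst_preimage_swap] at hcon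
    obtain ⟨⟨x, y⟩, hxy⟩ := hne.mono hSM
    obtain ⟨v, w, hvw, hi⟩ := hMiso.swap.exists_insert hT hreg ⟨(y, x), hxy⟩ hcon
    have hi' : IsPartialIsometry T (Insert.insert (w, v) M) := by
      convert hi.swap using 1
      ext ⟨x, y⟩
      simp [and_comm]
    exact hvw (hM.le_of_ge hi' (Set.subset_insert _ _) (Set.mem_insert _ _))
  have hf : ∀ a, ∃ b, (a, b) ∈ M := fun a => by
    obtain ⟨⟨a, b⟩, hab, rfl⟩ := h1.symm ▸ Set.mem_univ a
    exact ⟨b, hab⟩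
  have hg : ∀ b, ∃ a, (a, b) ∈ M := fun b => by
    obtain ⟨⟨a, b⟩, hab, rfl⟩ := h2.symm ▸ Set.mem_univ b
    exact ⟨a, hab⟩
  choose f hf using hf
  choose g hg using hg
  refine ⟨⟨⟨f, g, fun a => ?_, fun b => ?_⟩, fun {a b} => ?_⟩, fun p hp => ?_⟩
  · exact (hMiso.eq_iff hT (hg _) (hf a)).2 rfl
  · exact (hMiso.eq_iff hT (hf _) (hg b)).1 rfl
  · exact (hMiso.adj_iff (hf a) (hf b)).symm
  · exact (hMiso.eq_iff hT (hf p.1) (hSM hp)).1 rfl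

end IsPartialIsometry

/-- Any two vertices of a regular tree are swapped by an automorphism. -/
theorem IsTree.exists_iso_swap [T.LocallyFinite] {d : ℕ} (hT : T.IsTree)
    (hreg : T.IsRegularOfDegree d) (x y : V) : ∃ g : T ≃g T, g x = y ∧ g y = x := by
  obtain ⟨p, hp, -⟩ := hT.connected.exists_path_of_dist x y
  -- The reversal of the geodesic from $x$ to $y$ is a partial isometry: it grows from the single
  -- pair $(x,y)$ by attaching one vertex at each end per step.
  have key : ∀ k ≤ p.length, IsPartialIsometry T
      ((fun i => (p.getVert i, p.getVert (p.length - i))) '' Set.Iic k) := by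
    intro k
    induction k with
    | zero =>
      intro _
      have h0 : Set.Iic 0 = ({0} : Set ℕ) := by ext; simp
      rw [h0, Set.image_singleton]
      exact .singleton hT _ _
    | succ k ih =>
      intro hk
      have hIic : Set.Iic (k + 1) = insert (k + 1) (Set.Iic k) := by
        ext i; simp only [Set.mem_Iic, Set.mem_insert_iff]; omega
      rw [hIic, Set.image_insert_eq]
      refine (ih (by omega)).insert hT (a := p.getVert k) (b := p.getVert (p.length - k))
        ⟨k, Set.mem_Iic.2 le_rfl, rfl⟩ ?_ ?_ (p.adj_getVert_succ (by omega)).symm ?_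
      · rintro ⟨_, ⟨i, hi, rfl⟩, h⟩
        rw [Set.mem_Iic] at hi
        have := hp.getVert_injOn (show i ≤ p.length by omega) hk h
        omega
      · rintro ⟨_, ⟨i, hi, rfl⟩, h⟩
        rw [Set.mem_Iic] at hi
        have := hp.getVert_injOn (show p.length - i ≤ p.length by omega)
          (show p.length - (k + 1) ≤ p.length by omega) h
        omega
      · have := p.adj_getVert_succ (i := p.length - (k + 1)) (by omega)
        rwa [show p.length - (k + 1) + 1 = p.length - k by omega] at this
  obtain ⟨g, hg⟩ := (key p.length le_rfl).exists_iso hT hreg ⟨_, 0, by simp, rfl⟩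
  refine ⟨g, ?_, ?_⟩
  · simpa using hg _ ⟨0, by simp, rfl⟩
  · simpa using hg _ ⟨p.length, by simp, rfl⟩

/-- Spheres about $o$ are countable by induction: each vertex of one sphere neighbours a vertex of
the preceding one. -/
theorem Connected.countable_of_locallyFinite [T.LocallyFinite] (hT : T.Connected) :
    Countable V := by
  obtain ⟨o⟩ := hT.nonempty
  have hfin : ∀ n, {v | T.dist o v = n}.Countable := by
    intro n
    induction n with
    | zero => simp [hT.dist_eq_zero_iff]
    | succ n ih =>
      refine (ih.biUnion (t := fun v _ => T.neighborSet v)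
        fun v _ => (Set.toFinite _).countable).mono ?_
      intro w hw
      obtain ⟨p, hp⟩ := hT.exists_walk_length_eq_dist w o
      have hw' : T.dist o w = n + 1 := hw
      rw [T.dist_comm, hw'] at hp
      cases p with
      | nil => simp at hp
      | @cons _ b _ hwb q =>
        rw [Walk.length_cons] at hp
        have h1 : T.dist b o ≤ q.length := dist_le q
        have h2 : T.dist w o ≤ T.dist w b + T.dist b o := hT.dist_triangle
        have h3 : T.dist w b = 1 := dist_eq_one_iff_adj.2 hwb
        rw [T.dist_comm, hw', h3, T.dist_comm] at h2
        rw [T.dist_comm] at h1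
        exact Set.mem_biUnion (show T.dist o b = n by omega) hwb.symm
  rw [← Set.countable_univ_iff]
  exact (Set.countable_iUnion hfin).mono fun v _ => Set.mem_iUnion.2 ⟨T.dist o v, rfl⟩

end SimpleGraph

/-! ### Equivariant operators and the trace property -/

namespace TreeOperator

variable {V : Type*}

theorem inner_delta_left (x : V) (f : EllTwo V) : ⟪delta x, f⟫_ℂ = f x := by
  classical
  unfold delta
  rw [lp.inner_single_left]
  simp

theorem norm_delta (x : V) : ‖(delta x : EllTwo V)‖ = 1 := by
  classical
  unfold delta
  rw [lp.norm_single (by norm_num)]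
  simp

theorem hasSum_smul_delta (f : EllTwo V) : HasSum (fun z => f z • (delta z : EllTwo V)) f := by
  classical
  convert lp.hasSum_single (p := 2) (by norm_num) f using 2 with z
  unfold delta
  rw [← lp.single_smul]
  simp

theorem hasSum_inner_mul (A B : EllTwo V →L[ℂ] EllTwo V) (x y : V) :
    HasSum (fun z => ⟪delta x, A (delta z)⟫_ℂ * ⟪delta z, B (delta y)⟫_ℂ)
      ⟪delta x, (A * B) (delta y)⟫_ℂ := by
  have h := (hasSum_smul_delta (B (delta y))).mapL ((innerSL ℂ (delta x)) ∘L A)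
  simpa [inner_delta_left, mul_comm, inner_smul_right] using h

/-- The shift permutes the coordinates of a product of identical measures. -/
theorem measurePreserving_shift {T : SimpleGraph V} (g : T ≃g T) :
    MeasurePreserving (shift g) (percolation V) (percolation V) := by
  have h : (shift g : Config V → Config V)
      = MeasurableEquiv.piCongrLeft (fun _ : V => Bool) g.toEquiv := by
    funext ω x
    obtain ⟨y, rfl⟩ := g.surjective x
    have := MeasurableEquiv.piCongrLeft_apply_apply g.toEquiv (β := fun _ : V => Bool) ω y
    refine Eq.trans ?_ this.symm
    simp [shift]
  refine ⟨?_, ?_⟩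
  · rw [h]; exact MeasurableEquiv.measurable _
  · rw [h]
    exact Measure.infinitePi_map_piCongrLeft
      (μ := fun _ : V => (PMF.uniformOfFintype Bool).toMeasure) g.toEquiv

theorem inner_delta_conj (e : V ≃ V) (A : EllTwo V →L[ℂ] EllTwo V) (x y : V) :
    ⟪delta (e x), (permUnitary e).conjStarAlgEquiv A (delta (e y))⟫_ℂ
      = ⟪delta x, A (delta y)⟫_ℂ := by
  rw [← permUnitary_delta, ← permUnitary_delta, LinearIsometryEquiv.conjStarAlgEquiv_apply_apply,
    LinearIsometryEquiv.symm_apply_apply, LinearIsometryEquiv.inner_map_map]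

variable {T : SimpleGraph V} {F G : Config V → EllTwo V →L[ℂ] EllTwo V}

theorem IsEquivariantOperator.ae_eq_conj (hF : IsEquivariantOperator T F) (g : T ≃g T) :
    ∀ᵐ ω ∂(percolation V), F (shift g ω) = (permUnitary g.toEquiv).conjStarAlgEquiv (F ω) :=
  hF.equivariant g

theorem IsEquivariantOperator.one : IsEquivariantOperator T (fun _ => 1) where
  aemeasurable _ _ := aemeasurable_const
  equivariant g := .of_forall fun _ => (map_one (permUnitary g.toEquiv).conjStarAlgEquiv).symm

theorem IsEquivariantOperator.add (hF : IsEquivariantOperator T F)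
    (hG : IsEquivariantOperator T G) : IsEquivariantOperator T (fun ω => F ω + G ω) where
  aemeasurable x y := by
    simp only [add_apply, inner_add_right]
    exact (hF.aemeasurable x y).add (hG.aemeasurable x y)
  equivariant g := by
    filter_upwards [hF.ae_eq_conj g, hG.ae_eq_conj g] with ω h1 h2
    rw [h1, h2]
    exact (map_add (permUnitary g.toEquiv).conjStarAlgEquiv _ _).symm

theorem IsEquivariantOperator.sub (hF : IsEquivariantOperator T F)
    (hG : IsEquivariantOperator T G) : IsEquivariantOperator T (fun ω => F ω - G ω) where
  aemeasurable x y := by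
    simp only [sub_apply, inner_sub_right]
    exact (hF.aemeasurable x y).sub (hG.aemeasurable x y)
  equivariant g := by
    filter_upwards [hF.ae_eq_conj g, hG.ae_eq_conj g] with ω h1 h2
    rw [h1, h2]
    exact (map_sub (permUnitary g.toEquiv).conjStarAlgEquiv _ _).symm

/-- A coefficient of a product is the limit of finite sums over intermediate vertices; countability
of $V$ makes this a limit along a countably generated filter. -/
theorem aemeasurable_inner_mul [Countable V]
    (hF : ∀ x y, AEMeasurable (fun ω => ⟪delta x, F ω (delta y)⟫_ℂ) (percolation V))
    (hG : ∀ x y, AEMeasurable (fun ω => ⟪delta x, G ω (delta y)⟫_ℂ) (percolation V)) (x y : V) :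
    AEMeasurable (fun ω => ⟪delta x, (F ω * G ω) (delta y)⟫_ℂ) (percolation V) :=
  aemeasurable_of_tendsto_metrizable_ae atTop
    (fun s : Finset V => Finset.aemeasurable_fun_sum s fun z _ => (hF x z).mul (hG z y))
    (.of_forall fun ω => hasSum_inner_mul (F ω) (G ω) x y)

theorem IsEquivariantOperator.mul [Countable V] (hF : IsEquivariantOperator T F)
    (hG : IsEquivariantOperator T G) : IsEquivariantOperator T (fun ω => F ω * G ω) where
  aemeasurable := aemeasurable_inner_mul hF.aemeasurable hG.aemeasurable
  equivariant g := by
    filter_upwards [hF.ae_eq_conj g, hG.ae_eq_conj g] with ω h1 h2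
    rw [h1, h2]
    exact (map_mul (permUnitary g.toEquiv).conjStarAlgEquiv _ _).symm

theorem IsEquivariantOperator.pow [Countable V] (hF : IsEquivariantOperator T F) (n : ℕ) :
    IsEquivariantOperator T (fun ω => F ω ^ n) := by
  induction n with
  | zero => simpa using IsEquivariantOperator.one
  | succ n ih => simpa only [pow_succ] using ih.mul hF

theorem IsEquivariantOperator.sum_range {F : ℕ → Config V → EllTwo V →L[ℂ] EllTwo V}
    (hF : ∀ i, IsEquivariantOperator T (F i)) (n : ℕ) :
    IsEquivariantOperator T (fun ω => ∑ i ∈ Finset.range n, F i ω) := by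
  induction n with
  | zero => simpa using IsEquivariantOperator.one.sub IsEquivariantOperator.one
  | succ n ih => simpa only [Finset.sum_range_succ] using ih.add (hF n)

theorem mulIndicator_apply (W : Set V) (f : EllTwo V) (x : V) :
    mulIndicator W f x = W.indicator (fun y => f y) x := rfl

theorem IsEquivariantSet.isEquivariantOperator_mulIndicator {W : Config V → Set V}
    (hW : IsEquivariantSet T W) : IsEquivariantOperator T (fun ω => mulIndicator (W ω)) where
  aemeasurable x y := by
    refine ((aemeasurable_const (b := (delta y : EllTwo V) x)).indicator₀
      (hW.nullMeasurable x)).congr (.of_forall fun ω => ?_)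
    refine Eq.trans ?_ (inner_delta_left x (mulIndicator (W ω) (delta y))).symm
    rw [mulIndicator_apply]
    by_cases h : x ∈ W ω <;> simp [h]
  equivariant g := by
    filter_upwards [hW.equivariant g] with ω h
    rw [h]
    ext f x
    obtain ⟨y, rfl⟩ := g.surjective x
    change (g '' W ω).indicator (fun z => f z) (g y)
      = (W ω).indicator (fun z => f (g z)) (g.symm (g y))
    rw [RelIso.symm_apply_apply]
    by_cases hy : y ∈ W ω <;> simp [hy]

/-- The row of $A$ at $x$ and the column of $B$ at $y$ are square summable, with norms at most $a$
and $b$. This bound, uniform in $\omega$, later allows expectation and sum to be exchanged. -/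
theorem sum_norm_inner_mul_le (A B : EllTwo V →L[ℂ] EllTwo V) {a b : ℝ} (hA : ‖A‖ ≤ a)
    (hB : ‖B‖ ≤ b) (x y : V) (s : Finset V) :
    ∑ z ∈ s, ‖⟪delta x, A (delta z)⟫_ℂ * ⟪delta z, B (delta y)⟫_ℂ‖ ≤ a ^ 2 + b ^ 2 := by
  have h1 := sum_sq_le (ContinuousLinearMap.adjoint A (delta x)) s
  have h2 := sum_sq_le (B (delta y)) s
  have hA' : ‖ContinuousLinearMap.adjoint A (delta x)‖ ≤ a := by
    refine ((ContinuousLinearMap.adjoint A).le_opNorm _).trans ?_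
    rwa [norm_delta, mul_one, LinearIsometryEquiv.norm_map]
  have hB' : ‖B (delta y)‖ ≤ b := by
    refine (B.le_opNorm _).trans ?_
    rwa [norm_delta, mul_one]
  simp only [ENNReal.toReal_ofNat, Real.rpow_ofNat] at h1 h2
  have h3 : ∀ z, ‖⟪delta x, A (delta z)⟫_ℂ‖ = ‖ContinuousLinearMap.adjoint A (delta x) z‖ := by
    intro z
    rw [← inner_delta_left z, ContinuousLinearMap.adjoint_inner_right, norm_inner_symm]
  calc ∑ z ∈ s, ‖⟪delta x, A (delta z)⟫_ℂ * ⟪delta z, B (delta y)⟫_ℂ‖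
      ≤ ∑ z ∈ s, (‖ContinuousLinearMap.adjoint A (delta x) z‖ ^ 2 + ‖B (delta y) z‖ ^ 2) := by
        refine Finset.sum_le_sum fun z _ => ?_
        rw [norm_mul, h3, inner_delta_left]
        nlinarith [sq_nonneg (‖ContinuousLinearMap.adjoint A (delta x) z‖ - ‖B (delta y) z‖),
          sq_nonneg ‖ContinuousLinearMap.adjoint A (delta x) z‖, sq_nonneg ‖B (delta y) z‖]
    _ ≤ a ^ 2 + b ^ 2 := by
        rw [Finset.sum_add_distrib]
        refine add_le_add (h1.trans ?_) (h2.trans ?_)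
        · gcongr
        · gcongr

theorem vnTrace_mul_eq_tsum [Countable V] (hF : IsEquivariantOperator T F)
    (hG : IsEquivariantOperator T G) {a b : ℝ} (ha : ∀ᵐ ω ∂(percolation V), ‖F ω‖ ≤ a)
    (hb : ∀ᵐ ω ∂(percolation V), ‖G ω‖ ≤ b) (o : V) :
    vnTrace o (fun ω => F ω * G ω)
      = ∑' z, ∫ ω, ⟪delta o, F ω (delta z)⟫_ℂ * ⟪delta z, G ω (delta o)⟫_ℂ
          ∂(percolation V) := by
  have hm : ∀ z, AEStronglyMeasurable
      (fun ω => ⟪delta o, F ω (delta z)⟫_ℂ * ⟪delta z, G ω (delta o)⟫_ℂ) (percolation V) :=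
    fun z => ((hF.aemeasurable o z).mul (hG.aemeasurable z o)).aestronglyMeasurable
  rw [← integral_tsum hm]
  · refine integral_congr_ae (.of_forall fun ω => ?_)
    exact (hasSum_inner_mul (F ω) (G ω) o o).tsum_eq.symm
  · rw [← lintegral_tsum fun z => (hm z).enorm]
    refine ne_top_of_le_ne_top (b := ENNReal.ofReal (a ^ 2 + b ^ 2)) ENNReal.ofReal_ne_top ?_
    calc _ ≤ ∫⁻ _, ENNReal.ofReal (a ^ 2 + b ^ 2) ∂(percolation V) := by
          refine lintegral_mono_ae ?_
          filter_upwards [ha, hb] with ω h1 h2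
          rw [ENNReal.tsum_eq_iSup_sum]
          refine iSup_le fun s => ?_
          simp only [← ofReal_norm]
          rw [← ENNReal.ofReal_sum_of_nonneg fun _ _ => norm_nonneg _]
          exact ENNReal.ofReal_le_ofReal (sum_norm_inner_mul_le _ _ h1 h2 o o s)
      _ = _ := by simp

/-- The trace property of `τ`, from the fact that automorphisms of a regular tree can swap any two
vertices. -/
theorem vnTrace_mul_comm [T.LocallyFinite] {d : ℕ} (hT : T.IsTree)
    (hreg : T.IsRegularOfDegree d) (hF : IsEquivariantOperator T F)
    (hG : IsEquivariantOperator T G) {a b : ℝ} (ha : ∀ᵐ ω ∂(percolation V), ‖F ω‖ ≤ a)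
    (hb : ∀ᵐ ω ∂(percolation V), ‖G ω‖ ≤ b) (o : V) :
    vnTrace o (fun ω => F ω * G ω) = vnTrace o (fun ω => G ω * F ω) := by
  have := hT.connected.countable_of_locallyFinite
  rw [vnTrace_mul_eq_tsum hF hG ha hb, vnTrace_mul_eq_tsum hG hF hb ha]
  refine tsum_congr fun z => ?_
  -- The two series agree term by term: a swap of $o$ and $z$ carries $F_{oz}G_{zo}$ to
  -- $F_{zo}G_{oz}$, and expectations are invariant. Transitivity alone would not give this termwise
  -- match.
  obtain ⟨g, hgo, hgz⟩ := hT.exists_iso_swap hreg o z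
  have hmp := measurePreserving_shift g
  have hm : AEStronglyMeasurable
      (fun ω => ⟪delta o, F ω (delta z)⟫_ℂ * ⟪delta z, G ω (delta o)⟫_ℂ) (percolation V) :=
    ((hF.aemeasurable o z).mul (hG.aemeasurable z o)).aestronglyMeasurable
  have h1 := integral_map (μ := percolation V) hmp.measurable.aemeasurable
    (by rw [hmp.map_eq]; exact hm)
  rw [hmp.map_eq] at h1
  rw [h1]
  refine integral_congr_ae ?_
  filter_upwards [hF.ae_eq_conj g, hG.ae_eq_conj g] with ω h2 h3
  have h4 := inner_delta_conj g.toEquiv (F ω) z o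
  have h5 := inner_delta_conj g.toEquiv (G ω) o z
  have e1 : g.toEquiv z = o := hgz
  have e2 : g.toEquiv o = z := hgo
  rw [e1, e2] at h4 h5
  rw [h2, h3, h4, h5, mul_comm]

end TreeOperator

namespace TreeOperator

/-- Polarization: convergence of quadratic forms is weak operator convergence. -/
theorem tendsto_inner_of_tendsto_inner_self {H : Type*} [NormedAddCommGroup H]
    [InnerProductSpace ℂ H] {A : H →L[ℂ] H} {S : ℕ → H →L[ℂ] H}
    (h : ∀ z, Tendsto (fun n => ⟪z, S n z⟫_ℂ) atTop (𝓝 ⟪z, A z⟫_ℂ)) (x y : H) :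
    Tendsto (fun n => ⟪x, S n y⟫_ℂ) atTop (𝓝 ⟪x, A y⟫_ℂ) := by
  have hc : ∀ z, Tendsto (fun n => ⟪(S n : H →ₗ[ℂ] H) z, z⟫_ℂ) atTop
      (𝓝 ⟪(A : H →ₗ[ℂ] H) z, z⟫_ℂ) := fun z => by
    have := (Complex.continuous_conj.tendsto _).comp (h z)
    rw [inner_conj_symm] at this
    exact this.congr fun n => inner_conj_symm _ _
  have h1 : Tendsto (fun n => ⟪(S n : H →ₗ[ℂ] H) y, x⟫_ℂ) atTop
      (𝓝 ⟪(A : H →ₗ[ℂ] H) y, x⟫_ℂ) := by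
    rw [inner_map_polarization']
    refine Tendsto.congr (fun n => (inner_map_polarization' _ _ _).symm) ?_
    exact ((((hc _).sub (hc _)).sub ((hc _).const_mul _)).add ((hc _).const_mul _)).div_const _
  have := (Complex.continuous_conj.tendsto _).comp h1
  rw [inner_conj_symm] at this
  exact this.congr fun n => inner_conj_symm _ _

/-! ### Spectral measures: energy bounds, symmetries, approximation -/

section SpectralTheory

variable {H : Type*} [NormedAddCommGroup H] [InnerProductSpace ℂ H] [CompleteSpace H]
  {A : H →L[ℂ] H}

theorem spectralMeasure_real_univ (hA : IsSelfAdjoint A) (x : H) :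
    (spectralMeasure A x).real Set.univ = ‖x‖ ^ 2 := by
  have h := integral_spectralMeasure_of_continuous A x (f := fun _ => (1 : ℝ)) continuous_const
  rw [cfc_const_one ℝ A, one_apply_eq_self, inner_self_eq_norm_sq_to_K] at h
  rw [integral_const, smul_eq_mul, mul_one] at h
  rw [h]
  norm_cast

theorem integral_id_spectralMeasure (hA : IsSelfAdjoint A) (x : H) :
    ∫ t, t ∂(spectralMeasure A x) = (⟪x, A x⟫_ℂ).re := by
  have h := integral_spectralMeasure_of_continuous A x (f := fun t => t) continuous_id
  rwa [cfc_id' ℝ A] at h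

theorem le_re_inner_of_mem_spectralSubspace_Ici (hA : IsSelfAdjoint A) {E : ℝ} {x : H}
    (hx : x ∈ spectralSubspace A (Set.Ici E)) : E * ‖x‖ ^ 2 ≤ (⟪x, A x⟫_ℂ).re := by
  rw [← integral_id_spectralMeasure hA, ← spectralMeasure_real_univ hA x, mul_comm,
    ← smul_eq_mul, ← integral_const]
  refine integral_mono_ae (integrable_const _)
    (integrable_spectralMeasure_of_continuous A x continuous_id) ?_
  filter_upwards [mem_ae_iff.2 (mem_spectralSubspace.1 hx)] with t ht
  exact ht

/-- Here $\mu_x$ lives on $t<E$, yet $\int(E-t)\,d\mu_x\le0$. A strictly positive function with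
nonpositive integral forces $\mu_x=0$, and the mass of $\mu_x$ is $\|x\|^2$. -/
theorem eq_zero_of_spectralProjection_Ici_eq_zero (hA : IsSelfAdjoint A) {E : ℝ}
    (h : spectralProjection A (Set.Ici E) = 0) {x : H}
    (hx : E * ‖x‖ ^ 2 ≤ (⟪x, A x⟫_ℂ).re) : x = 0 := by
  have h0 : spectralMeasure A x (Set.Ici E) = 0 := by
    have h1 := inner_spectralProjection hA (measurableSet_Ici (a := E)) x
    rw [h, zero_apply, inner_zero_right] at h1
    have h2 : (spectralMeasure A x).real (Set.Ici E) = 0 := by exact_mod_cast h1.symm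
    exact (measureReal_eq_zero_iff).1 h2
  have hlt : ∀ᵐ t ∂(spectralMeasure A x), t < E := by
    refine mem_ae_iff.2 (Eq.trans (congrArg _ ?_) h0)
    ext t; simp
  have hid : Integrable (fun t : ℝ => t) (spectralMeasure A x) :=
    integrable_spectralMeasure_of_continuous A x continuous_id
  have hint : Integrable (fun t => E - t) (spectralMeasure A x) := (integrable_const E).sub hid
  have hle : ∫ t, (E - t) ∂(spectralMeasure A x) ≤ 0 := by
    rw [integral_sub (integrable_const E) hid, integral_const, integral_id_spectralMeasure hA,
      spectralMeasure_real_univ hA, smul_eq_mul]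
    linarith
  have hnn : 0 ≤ᵐ[spectralMeasure A x] fun t => E - t := by
    filter_upwards [hlt] with t ht
    exact sub_nonneg.2 ht.le
  have hz := (integral_eq_zero_iff_of_nonneg_ae hnn hint).1
    (le_antisymm hle (integral_nonneg_of_ae hnn))
  have hF : ∀ᵐ _ ∂(spectralMeasure A x), False := by
    filter_upwards [hz, hlt] with t h1 h2
    have h3 : E - t = 0 := h1
    linarith
  have hμ : spectralMeasure A x Set.univ = 0 := by simpa [ae_iff] using hF
  have hu := spectralMeasure_real_univ hA x
  rw [(measureReal_eq_zero_iff).2 hμ] at hu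
  exact norm_eq_zero.1 (pow_eq_zero_iff (by norm_num) |>.1 hu.symm)

theorem spectralMeasure_neg (hA : IsSelfAdjoint A) (x : H) :
    spectralMeasure (-A) x = (spectralMeasure A x).map Neg.neg := by
  apply Measure.ext_of_integral_eq_on_compactlySupported
  intro f
  have h := integral_map (μ := spectralMeasure A x) (f := (f : ℝ → ℝ))
    measurable_neg.aemeasurable f.continuous.aestronglyMeasurable
  rw [h, integral_spectralMeasure,
    integral_spectralMeasure_of_continuous A x (f := fun t => f (-t))
      (f.continuous.comp continuous_neg), cfc_comp_neg (f : ℝ → ℝ) A]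

/-- Conjugation by $U$ is a continuous star-automorphism, so it commutes with the continuous
functional calculus, which determines the spectral measure. -/
theorem spectralMeasure_conj (hA : IsSelfAdjoint A) (U : H ≃ₗᵢ[ℂ] H) (x : H) :
    spectralMeasure (U.conjStarAlgEquiv A) (U x) = spectralMeasure A x := by
  apply Measure.ext_of_integral_eq_on_compactlySupported
  intro f
  have hU : Continuous U.conjStarAlgEquiv :=
    U.toContinuousLinearEquiv.conjContinuousAlgEquiv.continuous
  rw [integral_spectralMeasure, integral_spectralMeasure,
    ← StarAlgHomClass.map_cfc (S := ℂ) U.conjStarAlgEquiv (f : ℝ → ℝ) A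
      f.continuous.continuousOn hU hA (hA.map _), LinearIsometryEquiv.conjStarAlgEquiv_apply_apply,
    LinearIsometryEquiv.symm_apply_apply, LinearIsometryEquiv.inner_map_map]

theorem spectralProjection_conj (hA : IsSelfAdjoint A) (U : H ≃ₗᵢ[ℂ] H) {B : Set ℝ}
    (hB : MeasurableSet B) :
    spectralProjection (U.conjStarAlgEquiv A) B = U.conjStarAlgEquiv (spectralProjection A B) := by
  have key : ∀ x, ⟪x, spectralProjection (U.conjStarAlgEquiv A) B x⟫_ℂ
      = ⟪x, U.conjStarAlgEquiv (spectralProjection A B) x⟫_ℂ := by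
    intro x
    obtain ⟨y, rfl⟩ := U.surjective x
    rw [inner_spectralProjection (hA.map _) hB, spectralMeasure_conj hA,
      LinearIsometryEquiv.conjStarAlgEquiv_apply_apply, LinearIsometryEquiv.symm_apply_apply,
      LinearIsometryEquiv.inner_map_map, inner_spectralProjection hA hB]
  refine ContinuousLinearMap.coe_injective ((ext_inner_map _ _).1 fun x => ?_)
  rw [← inner_conj_symm]
  exact (congrArg _ (key x)).trans (inner_conj_symm _ _)

/-- Dominated convergence against each finite measure $\mu_z$ gives the quadratic forms, and
polarization the rest. -/
theorem tendsto_inner_cfc (hA : IsSelfAdjoint A) {f : ℕ → ℝ → ℝ} (hf : ∀ n, Continuous (f n))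
    (hf1 : ∀ n t, |f n t| ≤ 1) {B : Set ℝ} (hB : MeasurableSet B)
    (hlim : ∀ t, Tendsto (fun n => f n t) atTop (𝓝 (B.indicator 1 t))) (x y : H) :
    Tendsto (fun n => ⟪x, cfc (f n) A y⟫_ℂ) atTop (𝓝 ⟪x, spectralProjection A B y⟫_ℂ) := by
  refine tendsto_inner_of_tendsto_inner_self (fun z => ?_) x y
  have h1 : Tendsto (fun n => ∫ t, f n t ∂(spectralMeasure A z)) atTop
      (𝓝 (∫ t, B.indicator (1 : ℝ → ℝ) t ∂(spectralMeasure A z))) :=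
    tendsto_integral_of_dominated_convergence (fun _ => 1)
      (fun n => (hf n).aestronglyMeasurable) (integrable_const 1)
      (fun n => .of_forall fun t => hf1 n t) (.of_forall hlim)
  rw [integral_indicator_one hB] at h1
  rw [inner_spectralProjection hA hB]
  refine ((Complex.continuous_ofReal.tendsto _).comp h1).congr fun n => ?_
  have hs : IsSelfAdjoint (cfc (f n) A) := cfc_predicate _ A
  rw [Function.comp_apply, integral_spectralMeasure_of_continuous A z (hf n)]
  exact hs.isSymmetric.coe_re_inner_self_apply z

/-- Smooth functions that approximate the indicator function of `[E, ∞)`. -/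
noncomputable def smoothStep (E : ℝ) (n : ℕ) (t : ℝ) : ℝ :=
  -- The inner exponent is $-n^2(t-E)-n$: at most $-n$ for $t\ge E$, the endpoint included thanks to
  -- the term $-n$, and tending to $+\infty$ for $t<E$.
  Real.exp (-Real.exp (-(n : ℝ) ^ 2 * t + (n ^ 2 * E - n)))

theorem continuous_smoothStep (E : ℝ) (n : ℕ) : Continuous (smoothStep E n) := by
  unfold smoothStep; fun_prop

theorem abs_smoothStep_le_one (E : ℝ) (n : ℕ) (t : ℝ) : |smoothStep E n t| ≤ 1 := by
  unfold smoothStep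
  rw [abs_of_pos (Real.exp_pos _), Real.exp_le_one_iff, neg_nonpos]
  exact (Real.exp_pos _).le

theorem tendsto_smoothStep (E t : ℝ) :
    Tendsto (fun n => smoothStep E n t) atTop (𝓝 ((Set.Ici E).indicator 1 t)) := by
  have hn : Tendsto (fun n : ℕ => (n : ℝ)) atTop atTop := tendsto_natCast_atTop_atTop
  by_cases ht : E ≤ t
  · have h1 : Tendsto (fun n : ℕ => -(n : ℝ) ^ 2 * t + (n ^ 2 * E - n)) atTop atBot := by
      refine tendsto_atBot_mono (fun n => ?_) (tendsto_neg_atTop_atBot.comp hn)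
      simp only [Function.comp_apply]
      nlinarith [mul_nonneg (sq_nonneg (n : ℝ)) (sub_nonneg.2 ht)]
    have h2 := (Real.continuous_exp.tendsto _).comp (Real.tendsto_exp_atBot.comp h1).neg
    simpa [smoothStep, ht, Function.comp_def] using h2
  · have h1 : Tendsto (fun n : ℕ => -(n : ℝ) ^ 2 * t + (n ^ 2 * E - n)) atTop atTop := by
      have h3 : Tendsto (fun n : ℕ => (n : ℝ) * (n * (E - t) + -1)) atTop atTop :=
        hn.atTop_mul_atTop₀ (tendsto_atTop_add_const_right _ _
          (hn.atTop_mul_const (sub_pos.2 (not_le.1 ht))))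
      exact h3.congr fun n => by ring
    have h2 := Real.tendsto_exp_atBot.comp
      (tendsto_neg_atTop_atBot.comp (Real.tendsto_exp_atTop.comp h1))
    simpa [smoothStep, ht, Function.comp_def] using h2

/-- Iterated exponentials of an affine function are given by power series in $A$, so their matrix
coefficients depend measurably on those of $A$. -/
theorem cfc_smoothStep (hA : IsSelfAdjoint A) (E : ℝ) (n : ℕ) :
    cfc (smoothStep E n) A = NormedSpace.exp (-NormedSpace.exp
      ((-(n : ℝ) ^ 2) • A + ((n : ℝ) ^ 2 * E - n) • (1 : H →L[ℂ] H))) := by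
  have h1 : cfc (fun t : ℝ => -(n : ℝ) ^ 2 * t + (n ^ 2 * E - n)) A
      = (-(n : ℝ) ^ 2) • A + ((n : ℝ) ^ 2 * E - n) • (1 : H →L[ℂ] H) := by
    rw [cfc_add A (fun t : ℝ => -(n : ℝ) ^ 2 * t) (fun _ => (n : ℝ) ^ 2 * E - n)
      (by fun_prop) (by fun_prop), cfc_const_mul_id _ A, cfc_const _ A, Algebra.algebraMap_eq_smul_one]
  have hs1 : IsSelfAdjoint (cfc (fun t : ℝ => -(n : ℝ) ^ 2 * t + (n ^ 2 * E - n)) A) :=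
    cfc_predicate _ A
  have h2 : cfc (fun t : ℝ => Real.exp (-(n : ℝ) ^ 2 * t + (n ^ 2 * E - n))) A
      = NormedSpace.exp ((-(n : ℝ) ^ 2) • A + ((n : ℝ) ^ 2 * E - n) • (1 : H →L[ℂ] H)) := by
    rw [cfc_comp' Real.exp _ A (by fun_prop) (by fun_prop),
      CFC.real_exp_eq_normedSpace_exp hs1, h1]
  have hs2 : IsSelfAdjoint
      (cfc (fun t : ℝ => -Real.exp (-(n : ℝ) ^ 2 * t + (n ^ 2 * E - n))) A) :=
    cfc_predicate _ A
  unfold smoothStep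
  rw [cfc_comp' Real.exp _ A (by fun_prop) (by fun_prop), CFC.real_exp_eq_normedSpace_exp hs2,
    cfc_neg, h2]

end SpectralTheory

/-! ### Measurability and equivariance of spectral projections -/

section Measurability

variable {V : Type*} {F : Config V → EllTwo V →L[ℂ] EllTwo V}

theorem aemeasurable_inner_pow [Countable V]
    (hF : ∀ x y, AEMeasurable (fun ω => ⟪delta x, F ω (delta y)⟫_ℂ) (percolation V)) (n : ℕ) :
    ∀ x y, AEMeasurable (fun ω => ⟪delta x, (F ω ^ n) (delta y)⟫_ℂ) (percolation V) := by
  induction n with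
  | zero => exact fun x y => by simp
  | succ n ih => simpa only [pow_succ] using aemeasurable_inner_mul ih hF

theorem aemeasurable_inner_exp [Countable V]
    (hF : ∀ x y, AEMeasurable (fun ω => ⟪delta x, F ω (delta y)⟫_ℂ) (percolation V)) (x y : V) :
    AEMeasurable (fun ω => ⟪delta x, NormedSpace.exp (F ω) (delta y)⟫_ℂ) (percolation V) := by
  refine aemeasurable_of_tendsto_metrizable_ae atTop
    (f := fun (s : Finset ℕ) ω => ∑ k ∈ s,
      ((k.factorial : ℂ)⁻¹) * ⟪delta x, (F ω ^ k) (delta y)⟫_ℂ)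
    (fun s => Finset.aemeasurable_fun_sum s fun k _ =>
      (aemeasurable_inner_pow hF k x y).const_mul _) (.of_forall fun ω => ?_)
  have h := NormedSpace.exp_series_hasSum_exp' (𝕂 := ℂ) (F ω)
  have h2 := (h.mapL (ContinuousLinearMap.apply ℂ (EllTwo V) (delta y))).mapL
    (innerSL ℂ (delta x))
  simpa [HasSum, inner_smul_right] using h2

theorem aemeasurable_inner_spectralProjection_Ici [Countable V]
    (hF : ∀ x y, AEMeasurable (fun ω => ⟪delta x, F ω (delta y)⟫_ℂ) (percolation V))
    (hsa : ∀ᵐ ω ∂(percolation V), IsSelfAdjoint (F ω)) (E : ℝ) (x y : V) :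
    AEMeasurable (fun ω => ⟪delta x, spectralProjection (F ω) (Set.Ici E) (delta y)⟫_ℂ)
      (percolation V) := by
  have hlin : ∀ (a b : ℝ) (x y : V), AEMeasurable
      (fun ω => ⟪delta x, (a • F ω + b • (1 : EllTwo V →L[ℂ] EllTwo V)) (delta y)⟫_ℂ)
      (percolation V) := fun a b x y => by
    refine (((hF x y).const_mul (a : ℂ)).add
      (aemeasurable_const (b := (b : ℂ) * ⟪delta x, (delta y : EllTwo V)⟫_ℂ))).congr
      (.of_forall fun ω => ?_)
    change _ = ⟪delta x, (a : ℂ) • F ω (delta y) + (b : ℂ) • delta y⟫_ℂ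
    rw [inner_add_right, inner_smul_right, inner_smul_right]
    rfl
  refine aemeasurable_of_tendsto_metrizable_ae atTop (fun n => ?_) (f := fun (n : ℕ) ω =>
    ⟪delta x, NormedSpace.exp (-NormedSpace.exp ((-(n : ℝ) ^ 2) • F ω
      + ((n : ℝ) ^ 2 * E - n) • (1 : EllTwo V →L[ℂ] EllTwo V))) (delta y)⟫_ℂ) ?_
  · refine aemeasurable_inner_exp (F := fun ω => -NormedSpace.exp ((-(n : ℝ) ^ 2) • F ω
      + ((n : ℝ) ^ 2 * E - n) • (1 : EllTwo V →L[ℂ] EllTwo V))) (fun x y => ?_) x y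
    exact (aemeasurable_inner_exp (hlin _ _) x y).neg.congr
      (.of_forall fun ω => (inner_neg_right _ _).symm)
  · filter_upwards [hsa] with ω hω
    have h := tendsto_inner_cfc hω (continuous_smoothStep E) (abs_smoothStep_le_one E)
      measurableSet_Ici (tendsto_smoothStep E) (delta x) (delta y)
    refine h.congr fun n => ?_
    rw [cfc_smoothStep hω]
    rfl

theorem IsEquivariantOperator.spectralProjection_Ici [Countable V] {T : SimpleGraph V}
    (hF : IsEquivariantOperator T F) (hsa : ∀ᵐ ω ∂(percolation V), IsSelfAdjoint (F ω)) (E : ℝ) :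
    IsEquivariantOperator T (fun ω => spectralProjection (F ω) (Set.Ici E)) where
  aemeasurable := aemeasurable_inner_spectralProjection_Ici hF.aemeasurable hsa E
  equivariant g := by
    filter_upwards [hF.ae_eq_conj g, hsa] with ω h1 h2
    rw [h1, spectralProjection_conj h2 _ measurableSet_Ici]
    rfl

end Measurability

end TreeOperator

namespace TreeOperator

/-! ### Mean ergodic theorem for a pair of projections -/

section Projections

variable {H : Type*} [NormedAddCommGroup H] [InnerProductSpace ℂ H] [CompleteSpace H]
  {p q : H →L[ℂ] H}

theorem isStarProjection_spectralProjection (A : H →L[ℂ] H) (B : Set ℝ) :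
    IsStarProjection (spectralProjection A B) :=
  ⟨Submodule.isIdempotentElem_starProjection _, isSelfAdjoint_starProjection _⟩

theorem one_sub_conj_nonneg (hp : IsStarProjection p) (hq : IsStarProjection q) :
    0 ≤ 1 - p * q * p := by
  have h := star_left_conjugate_le_conjugate hq.le_one p
  rw [hp.isSelfAdjoint.star_eq, mul_one, hp.isIdempotentElem.eq] at h
  exact sub_nonneg.2 (h.trans hp.le_one)

theorem norm_one_sub_conj_le_one (hp : IsStarProjection p) (hq : IsStarProjection q) :
    ‖1 - p * q * p‖ ≤ 1 :=
  (CStarAlgebra.norm_le_one_iff_of_nonneg _ (one_sub_conj_nonneg hp hq)).2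
    (sub_le_self _ (hp.isSelfAdjoint.conjugate_nonneg hq.nonneg))

theorem norm_pow_one_sub_conj_le_one (hp : IsStarProjection p) (hq : IsStarProjection q) (k : ℕ) :
    ‖(1 - p * q * p) ^ k‖ ≤ 1 := by
  rcases Nat.eq_zero_or_pos k with rfl | hk
  · rw [pow_zero]; exact ContinuousLinearMap.norm_id_le
  · exact (norm_pow_le' _ hk).trans
      (pow_le_one₀ (norm_nonneg _) (norm_one_sub_conj_le_one hp hq))

/-- Mean ergodic theorem for `1 - pqp`, when `q` is injective on the range of `p`. -/
theorem tendsto_average_inner_pow_one_sub_conj (hp : IsStarProjection p) (hq : IsStarProjection q)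
    (hker : ∀ x, p x = x → q x = 0 → x = 0) (z : H) :
    Tendsto (fun N : ℕ => (N : ℝ)⁻¹ *
      ∑ k ∈ Finset.range N, (⟪z, ((1 - p * q * p) ^ k) z⟫_ℂ).re) atTop
      (𝓝 (⟪z, (1 - p) z⟫_ℂ).re) := by
  have hpp : ∀ x, p (p x) = p x := fun x => congrArg (· x) hp.isIdempotentElem.eq
  have hqq : ∀ x, q (q x) = q x := fun x => congrArg (· x) hq.isIdempotentElem.eq
  have hps : ∀ x y, ⟪p x, y⟫_ℂ = ⟪x, p y⟫_ℂ := fun x y => hp.isSelfAdjoint.isSymmetric x y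
  have hqs : ∀ x y, ⟪q x, y⟫_ℂ = ⟪x, q y⟫_ℂ := fun x y => hq.isSelfAdjoint.isSymmetric x y
  set f : H →L[ℂ] H := 1 - p * q * p with hf
  -- If $pqpw=0$ then $\|qpw\|^2=\langle w,pqpw\rangle=0$, and injectivity of $q$ on the range of
  -- $p$ gives $pw=0$.
  have hfix : ∀ w, f w = w ↔ p w = 0 := fun w => by
    have h1 : f w = w - p (q (p w)) := rfl
    rw [h1, sub_eq_self]
    refine ⟨fun h => ?_, fun h => by rw [h, map_zero, map_zero]⟩
    refine hker _ (hpp w) (inner_self_eq_zero (𝕜 := ℂ).1 ?_)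
    rw [hqs, hqq, hps, h, inner_zero_right]
  have hlim := f.tendsto_birkhoffAverage_orthogonalProjection
    (norm_one_sub_conj_le_one hp hq) z
  have hproj : (((f.eqLocus (1 : H →L[ℂ] H)).orthogonalProjectionOnto z :
      f.eqLocus (1 : H →L[ℂ] H)) : H) = (1 - p) z := by
    rw [← Submodule.starProjection_apply (f.eqLocus (1 : H →L[ℂ] H)) z]
    refine Submodule.eq_starProjection_of_mem_of_inner_eq_zero ?_ fun w hw => ?_
    · refine (hfix _).2 ?_
      change p (z - p z) = 0
      rw [map_sub, hpp, sub_self]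
    · have hw' : p w = 0 := (hfix w).1 hw
      have h2 : z - (1 - p) z = p z := sub_sub_cancel z (p z)
      rw [h2, hps, hw', inner_zero_right]
  rw [hproj] at hlim
  have h3 := (Complex.continuous_re.tendsto _).comp
    ((tendsto_const_nhds (x := z)).inner hlim (𝕜 := ℂ))
  refine h3.congr fun N => ?_
  have hit : ∀ k : ℕ, f^[k] z = (f ^ k) z := fun k => by
    rw [FunLike.coe_pow_eq_iterate]
  simp only [Function.comp_apply, birkhoffAverage, birkhoffSum, id, hit]
  rw [inner_smul_right, inner_sum, ← Complex.ofReal_natCast, ← Complex.ofReal_inv,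
    Complex.re_ofReal_mul, Complex.re_sum]

end Projections

/-! ### Algebraic identities behind the equality of traces -/

section Ring

variable {R : Type*} [Ring R]

/-- A geometric sum gives the form $AB$ with $A=pq$ and $B=qp\sum_i(1-pqp)^i$. The companion
identity below is $BA$ for the same $A$ and $B$. -/
theorem one_sub_pow_one_sub_conj {p q : R} (hq : q * q = q) (k : ℕ) :
    1 - (1 - p * q * p) ^ k
      = (p * q) * (q * p * ∑ i ∈ Finset.range k, (1 - p * q * p) ^ i) := by
  rw [← mul_neg_geom_sum, sub_sub_cancel, ← mul_assoc, ← mul_assoc, mul_assoc p q q, hq]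

/-- The intertwining $qp(1-pqp)=(1-qpq)qp$ moves the geometric sum across $qp$. -/
theorem one_sub_pow_one_sub_conj' {p q : R} (hp : p * p = p) (hq : q * q = q) (k : ℕ) :
    1 - (1 - q * p * q) ^ k
      = (q * p * ∑ i ∈ Finset.range k, (1 - p * q * p) ^ i) * (p * q) := by
  have h : SemiconjBy (q * p) (1 - p * q * p) (1 - q * p * q) := by
    have e1 : q * p * (p * q * p) = q * (p * p) * q * p := by noncomm_ring
    have e2 : q * p * q * (q * p) = q * p * (q * q) * p := by noncomm_ring
    rw [SemiconjBy, mul_sub, sub_mul, mul_one, one_mul, e1, e2, hp, hq]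
  have h2 : q * p * ∑ i ∈ Finset.range k, (1 - p * q * p) ^ i
      = (∑ i ∈ Finset.range k, (1 - q * p * q) ^ i) * (q * p) := by
    rw [Finset.mul_sum, Finset.sum_mul]
    exact Finset.sum_congr rfl fun i _ => (h.pow_right i).eq
  have e3 : q * p * (p * q) = q * (p * p) * q := by noncomm_ring
  rw [h2, mul_assoc _ (q * p), e3, hp, ← geom_sum_mul_neg, sub_sub_cancel]

end Ring

/-! ### Comparing the traces of two projections -/

variable {V : Type*} {T : SimpleGraph V}

theorem isStarProjection_mulIndicator (W : Set V) : IsStarProjection (mulIndicator W) where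
  isIdempotentElem := by
    ext f x
    change W.indicator (fun y => W.indicator (fun y => f y) y) x = W.indicator (fun y => f y) x
    by_cases h : x ∈ W <;> simp [h]
  isSelfAdjoint := by
    rw [ContinuousLinearMap.isSelfAdjoint_iff_isSymmetric]
    intro f g
    refine (lp.inner_eq_tsum _ _).trans (Eq.trans (tsum_congr fun x => ?_)
      (lp.inner_eq_tsum _ _).symm)
    change ⟪W.indicator (fun y => f y) x, g x⟫_ℂ = ⟪f x, W.indicator (fun y => g y) x⟫_ℂ
    by_cases h : x ∈ W <;> simp [h]

theorem norm_inner_delta_le {A : EllTwo V →L[ℂ] EllTwo V} {a : ℝ} (hA : ‖A‖ ≤ a) (x : V) :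
    ‖⟪delta x, A (delta x)⟫_ℂ‖ ≤ a := by
  have h1 : ‖A (delta x)‖ ≤ a := by
    refine (A.le_opNorm _).trans ?_
    rwa [norm_delta, mul_one]
  have h2 : ‖⟪delta x, A (delta x)⟫_ℂ‖ ≤ ‖(delta x : EllTwo V)‖ * ‖A (delta x)‖ :=
    norm_inner_le_norm (𝕜 := ℂ) (delta x : EllTwo V) (A (delta x))
  rw [norm_delta, one_mul] at h2
  exact h2.trans h1

theorem inner_delta_self (x : V) : ⟪delta x, (delta x : EllTwo V)⟫_ℂ = 1 := by
  have h := inner_self_eq_norm_sq_to_K (𝕜 := ℂ) (delta x : EllTwo V)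
  rw [norm_delta] at h
  simpa using h

theorem IsEquivariantOperator.integrable_rootCoeff {F : Config V → EllTwo V →L[ℂ] EllTwo V}
    (hF : IsEquivariantOperator T F) {a : ℝ} (ha : ∀ᵐ ω ∂(percolation V), ‖F ω‖ ≤ a) (o : V) :
    Integrable (rootCoeff o F) (percolation V) := by
  refine Integrable.mono' (integrable_const a) (hF.aemeasurable o o).aestronglyMeasurable ?_
  filter_upwards [ha] with ω h
  exact norm_inner_delta_le h o

variable {R Q : Config V → EllTwo V →L[ℂ] EllTwo V}

theorem IsEquivariantOperator.one_sub_conj_pow [Countable V] (hR : IsEquivariantOperator T R)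
    (hQ : IsEquivariantOperator T Q) (k : ℕ) :
    IsEquivariantOperator T (fun ω => (1 - R ω * Q ω * R ω) ^ k) :=
  (IsEquivariantOperator.one.sub ((hR.mul hQ).mul hR)).pow k

theorem vnTrace_one_sub {F : Config V → EllTwo V →L[ℂ] EllTwo V} {o : V}
    (hF : Integrable (rootCoeff o F) (percolation V)) :
    vnTrace o (fun ω => 1 - F ω) = 1 - vnTrace o F := by
  have h1 : ∀ ω, rootCoeff o (fun ω => 1 - F ω) ω = 1 - rootCoeff o F ω := fun ω => by
    rw [← inner_delta_self o]
    exact inner_sub_right _ _ _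
  unfold vnTrace
  simp only [h1]
  rw [integral_sub (integrable_const _) hF]
  simp

/-- Both sides are one minus the trace of a product, $AB$ or $BA$; the factors have norm at most $1$
and $k$, so the trace property applies. -/
theorem vnTrace_one_sub_conj_pow [T.LocallyFinite] {d : ℕ} (hT : T.IsTree)
    (hreg : T.IsRegularOfDegree d) (hR : IsEquivariantOperator T R)
    (hQ : IsEquivariantOperator T Q) (hRp : ∀ᵐ ω ∂(percolation V), IsStarProjection (R ω))
    (hQp : ∀ᵐ ω ∂(percolation V), IsStarProjection (Q ω)) (k : ℕ) (o : V) :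
    vnTrace o (fun ω => (1 - R ω * Q ω * R ω) ^ k)
      = vnTrace o (fun ω => (1 - Q ω * R ω * Q ω) ^ k) := by
  have := hT.connected.countable_of_locallyFinite
  have hA : IsEquivariantOperator T (fun ω => R ω * Q ω) := hR.mul hQ
  have hB : IsEquivariantOperator T
      (fun ω => Q ω * R ω * ∑ i ∈ Finset.range k, (1 - R ω * Q ω * R ω) ^ i) :=
    (hQ.mul hR).mul (.sum_range (fun i => hR.one_sub_conj_pow hQ i) k)
  have hmul : ∀ {x y : EllTwo V →L[ℂ] EllTwo V} {a b : ℝ}, ‖x‖ ≤ a → ‖y‖ ≤ b → ‖x * y‖ ≤ a * b :=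
    fun hx hy => (norm_mul_le _ _).trans
      (mul_le_mul hx hy (norm_nonneg _) ((norm_nonneg _).trans hx))
  have hAn : ∀ᵐ ω ∂(percolation V), ‖R ω * Q ω‖ ≤ 1 * 1 := by
    filter_upwards [hRp, hQp] with ω h1 h2
    exact hmul h1.norm_le h2.norm_le
  have hBn : ∀ᵐ ω ∂(percolation V),
      ‖Q ω * R ω * ∑ i ∈ Finset.range k, (1 - R ω * Q ω * R ω) ^ i‖ ≤ 1 * 1 * k := by
    filter_upwards [hRp, hQp] with ω h1 h2
    refine hmul (hmul h2.norm_le h1.norm_le) ?_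
    refine (norm_sum_le_of_le _ fun i _ => norm_pow_one_sub_conj_le_one h1 h2 i).trans ?_
    simp
  have key := vnTrace_mul_comm hT hreg hA hB hAn hBn o
  have hAB := (hA.mul hB).integrable_rootCoeff (a := 1 * 1 * (1 * 1 * k))
    (by filter_upwards [hAn, hBn] with ω h1 h2 using hmul h1 h2) o
  have hBA := (hB.mul hA).integrable_rootCoeff (a := 1 * 1 * k * (1 * 1))
    (by filter_upwards [hAn, hBn] with ω h1 h2 using hmul h2 h1) o
  have h1 : vnTrace o (fun ω => (1 - R ω * Q ω * R ω) ^ k)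
      = vnTrace o (fun ω => 1 - (R ω * Q ω) *
        (Q ω * R ω * ∑ i ∈ Finset.range k, (1 - R ω * Q ω * R ω) ^ i)) := by
    refine integral_congr_ae ?_
    filter_upwards [hRp, hQp] with ω h1 h2
    rw [rootCoeff, rootCoeff, ← one_sub_pow_one_sub_conj h2.isIdempotentElem.eq, sub_sub_cancel]
  have h2 : vnTrace o (fun ω => (1 - Q ω * R ω * Q ω) ^ k)
      = vnTrace o (fun ω => 1 -
        (Q ω * R ω * ∑ i ∈ Finset.range k, (1 - R ω * Q ω * R ω) ^ i) * (R ω * Q ω)) := by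
    refine integral_congr_ae ?_
    filter_upwards [hRp, hQp] with ω h1 h2
    rw [rootCoeff, rootCoeff, ← one_sub_pow_one_sub_conj' h1.isIdempotentElem.eq
      h2.isIdempotentElem.eq, sub_sub_cancel]
  rw [h1, h2, vnTrace_one_sub hAB, vnTrace_one_sub hBA, key]

/-- For $o\notin W$ the vector $\delta_o$ is killed by $1_W$, hence fixed by every power; for $o\in
W$ positivity suffices. -/
theorem indicator_compl_le_re_inner_pow {W : Set V} {A : EllTwo V →L[ℂ] EllTwo V}
    (hA : IsStarProjection A) (k : ℕ) (o : V) :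
    Wᶜ.indicator 1 o ≤
      (⟪delta o, ((1 - mulIndicator W * A * mulIndicator W) ^ k) (delta o)⟫_ℂ).re := by
  by_cases ho : o ∈ W
  · have h := CStarAlgebra.pow_nonneg
      (one_sub_conj_nonneg (isStarProjection_mulIndicator W) hA) k
    have h2 := ((ContinuousLinearMap.nonneg_iff_isPositive _).1 h).re_inner_nonneg_right (delta o)
    simpa [ho] using h2
  · have hQ : mulIndicator W (delta o) = 0 := by
      ext x
      rw [mulIndicator_apply]
      by_cases hx : x ∈ W
      · have hxo : x ≠ o := fun h => ho (h ▸ hx)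
        simp [hx, delta, hxo]
      · simp [hx]
    have h1 : (1 - mulIndicator W * A * mulIndicator W) (delta o) = delta o := by
      change delta o - mulIndicator W (A (mulIndicator W (delta o))) = delta o
      rw [hQ, map_zero, map_zero, sub_zero]
    have h2 : ((1 - mulIndicator W * A * mulIndicator W) ^ k) (delta o) = delta o := by
      rw [FunLike.coe_pow_eq_iterate]
      exact Function.iterate_fixed h1 k
    rw [h2, inner_delta_self]
    simp [ho]

/-- If an equivariant random projection meets the kernel of `1_W` trivially, then its trace is at
most `ℙ(o ∈ W)`. -/
theorem integral_re_rootCoeff_le [T.LocallyFinite] {d : ℕ} (hT : T.IsTree)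
    (hreg : T.IsRegularOfDegree d) (hR : IsEquivariantOperator T R)
    (hRp : ∀ᵐ ω ∂(percolation V), IsStarProjection (R ω)) {W : Config V → Set V}
    (hW : IsEquivariantSet T W)
    (hker : ∀ᵐ ω ∂(percolation V), ∀ x, R ω x = x → mulIndicator (W ω) x = 0 → x = 0) (o : V) :
    ∫ ω, (rootCoeff o R ω).re ∂(percolation V) ≤ (percolation V).real {ω | o ∈ W ω} := by
  have := hT.connected.countable_of_locallyFinite
  have hQ := hW.isEquivariantOperator_mulIndicator
  have hQp : ∀ᵐ ω ∂(percolation V), IsStarProjection (mulIndicator (W ω)) :=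
    .of_forall fun ω => isStarProjection_mulIndicator _
  set u : ℕ → Config V → ℝ := fun k ω =>
    (rootCoeff o (fun ω => (1 - R ω * mulIndicator (W ω) * R ω) ^ k) ω).re with hu
  have hi1 : ∀ k, Integrable
      (rootCoeff o fun ω => (1 - R ω * mulIndicator (W ω) * R ω) ^ k) (percolation V) := fun k =>
    (hR.one_sub_conj_pow hQ k).integrable_rootCoeff (a := 1) (by
      filter_upwards [hRp, hQp] with ω h1 h2 using norm_pow_one_sub_conj_le_one h1 h2 k) o
  have hi2 : ∀ k, Integrable
      (rootCoeff o fun ω => (1 - mulIndicator (W ω) * R ω * mulIndicator (W ω)) ^ k)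
      (percolation V) := fun k =>
    (hQ.one_sub_conj_pow hR k).integrable_rootCoeff (a := 1) (by
      filter_upwards [hRp, hQp] with ω h1 h2 using norm_pow_one_sub_conj_le_one h2 h1 k) o
  have hui : ∀ k, Integrable (u k) (percolation V) := fun k => (hi1 k).re
  have hub : ∀ᵐ ω ∂(percolation V), ∀ k, |u k ω| ≤ 1 := by
    filter_upwards [hRp, hQp] with ω h1 h2 k
    exact (Complex.abs_re_le_norm _).trans
      (norm_inner_delta_le (norm_pow_one_sub_conj_le_one h1 h2 k) o)
  have hnull := (hW.nullMeasurable o).compl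
  -- The bound is visible only for $(1-QRQ)^k$, where $Q$ is diagonal; equality of traces transfers
  -- it to $(1-RQR)^k$.
  have hlow : ∀ k, 1 - (percolation V).real {ω | o ∈ W ω} ≤ ∫ ω, u k ω ∂(percolation V) := by
    intro k
    have e1 : ∫ ω, u k ω ∂(percolation V)
        = (vnTrace o fun ω => (1 - R ω * mulIndicator (W ω) * R ω) ^ k).re :=
      integral_re (hi1 k)
    have e2 : (vnTrace o fun ω => (1 - mulIndicator (W ω) * R ω * mulIndicator (W ω)) ^ k).re
        = ∫ ω, (rootCoeff o
          (fun ω => (1 - mulIndicator (W ω) * R ω * mulIndicator (W ω)) ^ k) ω).re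
          ∂(percolation V) := (integral_re (hi2 k)).symm
    rw [e1, vnTrace_one_sub_conj_pow hT hreg hR hQ hRp hQp, e2,
      ← probReal_compl_eq_one_sub₀ (hW.nullMeasurable o)]
    have e3 : (percolation V).real {ω | o ∈ W ω}ᶜ
        = ∫ ω, {ω | o ∈ W ω}ᶜ.indicator (fun _ => (1 : ℝ)) ω ∂(percolation V) := by
      rw [integral_indicator₀ hnull]; simp
    rw [e3]
    refine integral_mono_ae ((integrable_const (1 : ℝ)).indicator₀ hnull) (hi2 k).re ?_
    filter_upwards [hRp] with ω h1
    exact indicator_compl_le_re_inner_pow h1 k o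
  have hlim : Tendsto (fun N : ℕ => ∫ ω, (N : ℝ)⁻¹ * ∑ k ∈ Finset.range N, u k ω ∂(percolation V))
      atTop (𝓝 (∫ ω, (1 - (rootCoeff o R ω).re) ∂(percolation V))) := by
    refine tendsto_integral_of_dominated_convergence (fun _ => 1) (fun N => ?_)
      (integrable_const 1) (fun N => ?_) ?_
    · exact ((integrable_finsetSum _ fun k _ => hui k).const_mul _).aestronglyMeasurable
    · filter_upwards [hub] with ω h
      have h2 : ‖∑ k ∈ Finset.range N, u k ω‖ ≤ N := by
        refine (norm_sum_le_of_le _ fun k _ => h k).trans ?_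
        simp
      rw [norm_mul, norm_inv, Real.norm_natCast]
      exact inv_mul_le_one_of_le₀ h2 (Nat.cast_nonneg N)
    · filter_upwards [hRp, hQp, hker] with ω h1 h2 h3
      have h4 := tendsto_average_inner_pow_one_sub_conj h1 h2 h3 (delta o)
      have h5 : (⟪delta o, (1 - R ω) (delta o)⟫_ℂ).re = 1 - (rootCoeff o R ω).re := by
        have h6 : ⟪delta o, (1 - R ω) (delta o)⟫_ℂ = 1 - rootCoeff o R ω := by
          rw [← inner_delta_self o]
          exact inner_sub_right _ _ _
        rw [h6, Complex.sub_re, Complex.one_re]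
      rw [← h5]
      exact h4
  have hRi : Integrable (rootCoeff o R) (percolation V) :=
    hR.integrable_rootCoeff (a := 1) (by filter_upwards [hRp] with ω h using h.norm_le) o
  have hfin : 1 - (percolation V).real {ω | o ∈ W ω}
      ≤ ∫ ω, (1 - (rootCoeff o R ω).re) ∂(percolation V) := by
    refine ge_of_tendsto hlim ?_
    filter_upwards [eventually_gt_atTop 0] with N hN
    have hN' : (0 : ℝ) < N := Nat.cast_pos.2 hN
    rw [integral_const_mul, integral_finsetSum _ fun k _ => hui k, le_inv_mul_iff₀ hN']
    have := Finset.card_nsmul_le_sum (Finset.range N) (fun k => ∫ ω, u k ω ∂(percolation V)) _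
      fun k _ => hlow k
    simpa using this
  have hsub : ∫ ω, (1 - (rootCoeff o R ω).re) ∂(percolation V)
      = 1 - ∫ ω, (rootCoeff o R ω).re ∂(percolation V) := by
    have h := integral_sub (integrable_const (μ := percolation V) (1 : ℝ)) hRi.re
    refine h.trans ?_
    rw [integral_const, probReal_univ, one_smul]
    rfl
  linarith

end TreeOperator

/-! ### From compressions to the eigenvalue-counting bound -/

namespace TreeOperator

/-- Variational principle: a vector killed by $q$ has the same energy for $A$ and for its
compression. -/
theorem eq_zero_of_spectralProjection_compression_eq_zero {H : Type*} [NormedAddCommGroup H]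
    [InnerProductSpace ℂ H] [CompleteSpace H] {A q : H →L[ℂ] H} (hA : IsSelfAdjoint A)
    (hq : IsSelfAdjoint q) {E : ℝ} (h : spectralProjection ((1 - q) * A * (1 - q)) (Set.Ici E) = 0)
    {x : H} (hx : spectralProjection A (Set.Ici E) x = x) (hqx : q x = 0) : x = 0 := by
  have hs : IsSelfAdjoint (1 - q) := (IsSelfAdjoint.one _).sub hq
  have hC : IsSelfAdjoint ((1 - q) * A * (1 - q)) := by
    have := hA.conjugate (1 - q)
    rwa [hs.star_eq] at this
  refine eq_zero_of_spectralProjection_Ici_eq_zero hC h ?_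
  have hx' : (1 - q) x = x := by
    change x - q x = x
    rw [hqx, sub_zero]
  have h1 : ⟪x, ((1 - q) * A * (1 - q)) x⟫_ℂ = ⟪x, A x⟫_ℂ := by
    change ⟪x, (1 - q) (A ((1 - q) x))⟫_ℂ = _
    have h2 : ⟪(1 - q) x, A ((1 - q) x)⟫_ℂ = ⟪x, (1 - q) (A ((1 - q) x))⟫_ℂ :=
      hs.isSymmetric _ _
    rw [← h2, hx']
  rw [h1]
  exact le_re_inner_of_mem_spectralSubspace_Ici hA (Submodule.starProjection_eq_self_iff.1 hx)

theorem spectralMeasure_neg_real_Ici {H : Type*} [NormedAddCommGroup H]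
    [InnerProductSpace ℂ H] [CompleteSpace H] {A : H →L[ℂ] H} (hA : IsSelfAdjoint A) (E : ℝ)
    (x : H) :
    (spectralMeasure (-A) x).real (Set.Ici E) = (spectralMeasure A x).real (Set.Iic (-E)) := by
  rw [spectralMeasure_neg hA, map_measureReal_apply measurable_neg measurableSet_Ici]
  congr 1
  ext t
  simp

variable {V : Type*} {T : SimpleGraph V} {P : Config V → EllTwo V →L[ℂ] EllTwo V}

theorem IsEquivariantOperator.neg (hP : IsEquivariantOperator T P) :
    IsEquivariantOperator T (fun ω => -P ω) where
  aemeasurable x y := (hP.aemeasurable x y).neg.congr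
    (.of_forall fun ω => (inner_neg_right _ _).symm)
  equivariant g := by
    filter_upwards [hP.ae_eq_conj g] with ω h
    rw [h]
    exact (map_neg (permUnitary g.toEquiv).conjStarAlgEquiv _).symm

theorem rootCoeff_spectralProjection_ae (hsa : ∀ᵐ ω ∂(percolation V), IsSelfAdjoint (P ω))
    {B : Set ℝ} (hB : MeasurableSet B) (o : V) :
    (rootCoeff o fun ω => spectralProjection (P ω) B)
      =ᵐ[percolation V] fun ω => (((spectralMeasure (P ω) (delta o)).real B : ℝ) : ℂ) := by
  filter_upwards [hsa] with ω h
  exact inner_spectralProjection h hB _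

theorem integrable_spectralMeasure_real_Ici [Countable V] (hP : IsEquivariantOperator T P)
    (hsa : ∀ᵐ ω ∂(percolation V), IsSelfAdjoint (P ω)) (E : ℝ) (o : V) :
    Integrable (fun ω => (spectralMeasure (P ω) (delta o)).real (Set.Ici E)) (percolation V) := by
  have h := (hP.spectralProjection_Ici hsa E).integrable_rootCoeff (a := 1)
    (.of_forall fun ω => (isStarProjection_spectralProjection _ _).norm_le) o
  refine h.re.congr ?_
  filter_upwards [rootCoeff_spectralProjection_ae hsa measurableSet_Ici o] with ω hω
  rw [hω]
  exact Complex.ofReal_re _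

theorem integral_spectralMeasure_real_Ici_le [T.LocallyFinite] {d : ℕ} (hT : T.IsTree)
    (hreg : T.IsRegularOfDegree d) (hP : IsEquivariantOperator T P)
    (hsa : ∀ᵐ ω ∂(percolation V), IsSelfAdjoint (P ω)) {W : Config V → Set V}
    (hW : IsEquivariantSet T W) {E : ℝ}
    (hE : ∀ᵐ ω ∂(percolation V), spectralProjection
      ((1 - mulIndicator (W ω)) * P ω * (1 - mulIndicator (W ω))) (Set.Ici E) = 0) (o : V) :
    ∫ ω, (spectralMeasure (P ω) (delta o)).real (Set.Ici E) ∂(percolation V)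
      ≤ (percolation V).real {ω | o ∈ W ω} := by
  have := hT.connected.countable_of_locallyFinite
  refine le_trans (le_of_eq ?_) (integral_re_rootCoeff_le hT hreg
    (hP.spectralProjection_Ici hsa E)
    (.of_forall fun ω => isStarProjection_spectralProjection _ _) hW ?_ o)
  · refine integral_congr_ae ?_
    filter_upwards [rootCoeff_spectralProjection_ae hsa measurableSet_Ici o] with ω hω
    rw [hω, Complex.ofReal_re]
  · filter_upwards [hsa, hE] with ω h1 h2 x hx hqx
    exact eq_zero_of_spectralProjection_compression_eq_zero h1
      (isStarProjection_mulIndicator _).isSelfAdjoint h2 hx hqx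

theorem vnTrace_mulIndicator {W : Config V → Set V} (hW : IsEquivariantSet T W) (o : V) :
    vnTrace o (fun ω => mulIndicator (W ω)) = ((percolation V).real {ω | o ∈ W ω} : ℂ) := by
  have h : ∀ ω, rootCoeff o (fun ω => mulIndicator (W ω)) ω
      = {ω | o ∈ W ω}.indicator (fun _ => (1 : ℂ)) ω := fun ω => by
    refine (inner_delta_left o _).trans ?_
    rw [mulIndicator_apply]
    by_cases ho : o ∈ W ω <;> simp [ho, delta]
  unfold vnTrace
  simp only [h]
  rw [integral_indicator₀ (hW.nullMeasurable o)]
  simp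

/-- Measurability is known for half-lines only. For $E\le0$ the union is all of $\mathbb R$, with
constant mass $1$; for $E>0$ it is disjoint and the masses add. -/
theorem integrable_spectralMeasure_real_union [Countable V] (hP : IsEquivariantOperator T P)
    (hsa : ∀ᵐ ω ∂(percolation V), IsSelfAdjoint (P ω)) (E : ℝ) (o : V) :
    Integrable (fun ω => (spectralMeasure (P ω) (delta o)).real (Set.Iic (-E) ∪ Set.Ici E))
      (percolation V) := by
  have hsa' : ∀ᵐ ω ∂(percolation V), IsSelfAdjoint (-P ω) := hsa.mono fun _ h => h.neg
  rcases le_or_gt E 0 with hE | hE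
  · have hu : Set.Iic (-E) ∪ Set.Ici E = Set.univ := by
      ext t
      simp only [Set.mem_union, Set.mem_Iic, Set.mem_Ici, Set.mem_univ, iff_true]
      rcases le_total E t with h | h
      · exact Or.inr h
      · exact Or.inl (by linarith)
    refine (integrable_const (1 : ℝ)).congr ?_
    filter_upwards [hsa] with ω h
    rw [hu, spectralMeasure_real_univ h, norm_delta, one_pow]
  · refine ((integrable_spectralMeasure_real_Ici hP.neg hsa' E o).add
      (integrable_spectralMeasure_real_Ici hP hsa E o)).congr ?_
    filter_upwards [hsa] with ω h
    rw [Pi.add_apply, spectralMeasure_neg_real_Ici h, measureReal_union _ measurableSet_Ici]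
    exact Set.disjoint_left.2 fun t h1 h2 => by
      rw [Set.mem_Iic] at h1
      rw [Set.mem_Ici] at h2
      linarith

end TreeOperator

/-! ### The theorem -/

theorem mainTheorem7 {V : Type*} (T : SimpleGraph V) [T.LocallyFinite] (d : ℕ) (hd : 3 ≤ d)
    (hT : T.IsTree) (hreg : T.IsRegularOfDegree d) (o : V)
    (P : Config V → EllTwo V →L[ℂ] EllTwo V) (hP : IsEquivariantOperator T P)
    (hsa : ∀ᵐ ω ∂(percolation V), IsSelfAdjoint (P ω))
    (W : Config V → Set V) (hW : IsEquivariantSet T W)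
    (Q : Config V → EllTwo V →L[ℂ] EllTwo V) (hQ : ∀ ω, Q ω = mulIndicator (W ω))
    (E : ℝ)
    (hE : ∀ᵐ ω ∂(percolation V),
      spectralProjection ((1 - Q ω) * P ω * (1 - Q ω)) (Set.Ici E) = 0) :
    (Integrable (rootCoeff o fun ω => spectralProjection (P ω) (Set.Ici E)) (percolation V) ∧
      vnTrace o (fun ω => spectralProjection (P ω) (Set.Ici E))
        ≤ vnTrace o Q ∧
      vnTrace o Q = ((percolation V).real {ω | o ∈ W ω} : ℂ)) ∧
    ((∀ᵐ ω ∂(percolation V),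
        spectralProjection ((1 - Q ω) * (-P ω) * (1 - Q ω)) (Set.Ici E) = 0) →
      Integrable (rootCoeff o fun ω => spectralProjection (P ω) (Set.Iic (-E) ∪ Set.Ici E))
          (percolation V) ∧
      vnTrace o (fun ω => spectralProjection (P ω) (Set.Iic (-E) ∪ Set.Ici E))
        ≤ 2 * ((percolation V).real {ω | o ∈ W ω} : ℂ)) := by
  have := hT.connected.countable_of_locallyFinite
  obtain rfl : Q = fun ω => mulIndicator (W ω) := funext hQ
  have hi := integrable_spectralMeasure_real_Ici hP hsa E o
  have hle := integral_spectralMeasure_real_Ici_le hT hreg hP hsa hW hE o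
  have hae := rootCoeff_spectralProjection_ae hsa (measurableSet_Ici (a := E)) o
  refine ⟨⟨hi.ofReal.congr hae.symm, ?_, vnTrace_mulIndicator hW o⟩, fun hE' => ?_⟩
  · rw [vnTrace_mulIndicator hW, vnTrace, integral_congr_ae hae, integral_complex_ofReal]
    exact Complex.real_le_real.2 hle
  · have hsa' : ∀ᵐ ω ∂(percolation V), IsSelfAdjoint (-P ω) := hsa.mono fun _ h => h.neg
    have hi' := integrable_spectralMeasure_real_Ici hP.neg hsa' E o
    have hle' := integral_spectralMeasure_real_Ici_le hT hreg hP.neg hsa' hW hE' o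
    have hiu := integrable_spectralMeasure_real_union hP hsa E o
    have haeu := rootCoeff_spectralProjection_ae hsa
      ((measurableSet_Iic (a := -E)).union (measurableSet_Ici (a := E))) o
    refine ⟨hiu.ofReal.congr haeu.symm, ?_⟩
    rw [vnTrace, integral_congr_ae haeu, integral_complex_ofReal]
    -- Subadditivity suffices, so an overlap of the half-lines when $E\le0$ does no harm; each of
    -- the two terms contributes one factor $\mathbb P(o\in W)$.
    have hsum : ∫ ω, (spectralMeasure (P ω) (delta o)).real (Set.Iic (-E) ∪ Set.Ici E)
          ∂(percolation V)
        ≤ ∫ ω, ((spectralMeasure (-P ω) (delta o)).real (Set.Ici E)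
          + (spectralMeasure (P ω) (delta o)).real (Set.Ici E)) ∂(percolation V) := by
      refine integral_mono_ae hiu (hi'.add hi) ?_
      filter_upwards [hsa] with ω h
      rw [spectralMeasure_neg_real_Ici h]
      exact measureReal_union_le _ _
    rw [integral_add hi' hi] at hsum
    have hreal : ∫ ω, (spectralMeasure (P ω) (delta o)).real (Set.Iic (-E) ∪ Set.Ici E)
          ∂(percolation V) ≤ 2 * (percolation V).real {ω | o ∈ W ω} := by linarith
    exact_mod_cast hreal
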